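/- **Theorem (cut-free completeness).** Let $L\in\{I,GD,ND,CD,GN,GC\}$. Every $L$-valid nested sequent is derivable in the cut-free nested calculus $N_L$. Here the notions are as follows. *Formulae and models.* For $I,GD$ formulae are built from denumerably many propositional variables by $\bot,\lor,\land,\supset$; for $ND,CD,GN,GC$ they are built from atoms $p(x_1,\dots,x_n)$ (denumerably many predicates of each arity $n\ge 0$, arguments variables) by $\bot,\lor,\land,\supset,\exists x,\forall x$. A frame is a non-empty set $W$ with a reflexive transitive relation $\le$; it is connected if $w\le u$ and $w\le v$ imply $u\le v$ or $v\le u$. An $I$-model is a frame with a valuation of the propositional variables that is monotone along $\le$. An $ND$-model is a frame with non-empty domains $D(w)$, where $D(w)\subseteq D(v)$ if $w\le v$, and $V(p,w)\subseteq D(w)^n$ monotone along $\le$. $CD$-models are the $ND$-models with $D(w)=D(u)$ for all $w,u\in W$; $GD$-, $GN$-, $GC$-models are the $I$-, $ND$-, $CD$-models, respectively, with connected frame. Assignments map variables to $\bigcup_{w}D(w)$. Forcing is the usual Kripke forcing: $w\Vdash\phi\supset\psi$ iff for all $u\ge w$, $u\Vdash\phi$ implies $u\Vdash\psi$; $w,\mu\Vdash\exists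 x\phi$ iff $w,\mu[d/x]\Vdash\phi$ for some $d\in D(w)$; $w,\mu\Vdash\forall x\phi$ iff $u,\mu[d/x]\Vdash\phi$ for all $u\ge w$ and $d\in D(u)$. *Nested sequents.* A nested sequent is a finite expression $\Gamma,[\Delta_1]_{w_1},\dots,[\Delta_n]_{w_n}$ ($n\ge0$), taken up to the order of its members, where $\Gamma$ is a finite multiset of input formulae $\phi^\bullet$ and output formulae $\phi^\circ$, and the $\Delta_i$ are nested sequents; in the first-order case each component also carries a signature, i.e. a finite multiset $X$ of variables, written $X;\Gamma$. Labels are pairwise distinct and the root has its own label $w_0$. So a nested sequent is a tree of labelled components; $w\leadsto u$ means that there is a (possibly empty) path from $w$ down to $u$. A variable $x$ is available for $w$ if it belongs to the signature of some $u$-component with $u\leadsto w$. $\Sigma\{\dots\}_w$ displays data of the $w$-component (formulae, signature, nestings). A variable or label is fresh if it does not occur at all in the conclusion of the rule. $\phi(y/x)$ is capture-avoiding substitution. *Validity.* A propositional $\Sigma=\Delta^\bullet,\Pi^\circ,[\Delta_1]_{w_1},\dots,[\Delta_n]_{w_n}$ is $L$-valid if its formula interpretation $f(\Sigma)=\bigwedge\Delta\supset\bigvee\Pi\lor(f(\Delta_1)\lor\dots\lor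 f(\Delta_n))$ (for $n=0$: $\bigwedge\Delta\supset\bigvee\Pi$) is forced at all worlds of all $L$-models. In the first-order case let $\iota$ map labels to worlds and let $\mu$ be an assignment. A flat sequent $X;\Gamma$ is satisfied at $u$ if, whenever $\mu(x)\in D(\iota(u))$ for all $x\in X$ and $\iota(u),\mu\Vdash\phi$ for all $\phi^\bullet\in\Gamma$, then $\iota(u),\mu\Vdash\psi$ for some $\psi^\circ\in\Gamma$; $X;\Gamma,[\Delta_1]_{u_1},\dots,[\Delta_n]_{u_n}$ is satisfied at $u$ if, whenever $\iota(u)\le\iota(u_i)$ for all $i$, either $X;\Gamma$ is satisfied at $u$ or some $\Delta_i$ is satisfied at $u_i$. $\Sigma$ is $L$-valid if it is satisfied at $w_0$ for all $L$-models, all $\iota$ and all $\mu$. *Calculi* (premises / conclusion). - $(id)$: axiom $\Sigma\{p^\bullet\}_w\{p^\circ\}_u$ for $w\leadsto u$, $p$ atomic. $(\bot^\bullet)$: axiom $\Sigma\{\bot^\bullet\}_w$. - $(\lor^\bullet)$: $\Sigma\{\phi^\bullet\}_w$ and $\Sigma\{\psi^\bullet\}_w$ / $\Sigma\{\phi\lor\psi^\bullet\}_w$.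 $(\lor^\circ)$: $\Sigma\{\phi^\circ,\psi^\circ\}_w$ / $\Sigma\{\phi\lor\psi^\circ\}_w$. $(\land^\bullet)$: $\Sigma\{\phi^\bullet,\psi^\bullet\}_w$ / $\Sigma\{\phi\land\psi^\bullet\}_w$. $(\land^\circ)$: $\Sigma\{\phi^\circ\}_w$ and $\Sigma\{\psi^\circ\}_w$ / $\Sigma\{\phi\land\psi^\circ\}_w$. - $(\supset^\circ)$: $\Sigma\{[\phi^\bullet,\psi^\circ]_u\}_w$ / $\Sigma\{\phi\supset\psi^\circ\}_w$, $u$ fresh (empty signature at $u$). $(\supset^\bullet)$: $\Sigma\{\phi\supset\psi^\bullet\}_w\{\phi^\circ\}_u$ and $\Sigma\{\phi\supset\psi^\bullet\}_w\{\psi^\bullet\}_u$ / $\Sigma\{\phi\supset\psi^\bullet\}_w$, for $w\leadsto u$. - $(lin)$: $\Sigma\{[\Gamma,[\Delta]_u]_v\}_w$ and $\Sigma\{[\Delta,[\Gamma]_v]_u\}_w$ / $\Sigma\{[\Gamma]_v,[\Delta]_u\}_w$. - $(ds)$: $\Sigma\{X,\vec x;p(\vec x)^\bullet\}_w$ / $\Sigma\{X;p(\vec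 x)^\bullet\}_w$. - $(\exists^\bullet)$: $\Sigma\{X,y;\phi(y/x)^\bullet\}_w$ / $\Sigma\{X;\exists x\phi^\bullet\}_w$, $y$ fresh. $(\forall^\circ)$: $\Sigma\{[y;\phi(y/x)^\circ]_u\}_w$ / $\Sigma\{\forall x\phi^\circ\}_w$, $y,u$ fresh. - $(\exists^\circ_1)$: $\Sigma\{\phi(y/x)^\circ,\exists x\phi^\circ\}_w$ / $\Sigma\{\exists x\phi^\circ\}_w$, where $y$ is available for $w$ [any $y$]. $(\forall^\bullet_1)$: $\Sigma\{\forall x\phi^\bullet\}_w\{\phi(y/x)^\bullet\}_u$ / $\Sigma\{\forall x\phi^\bullet\}_w$, where $w\leadsto u$ and $y$ is available for $u$ [$w\leadsto u$, any $y$]. - $(\exists^\circ_2)$: $\Sigma\{X,y;\Gamma\}_w\{\phi(y/x)^\circ,\exists x\phi^\circ\}_u$ / $\Sigma\{X;\Gamma\}_w\{\exists x\phi^\circ\}_u$, where $w\leadsto u$, $y$ fresh [only $y$ fresh]. $(\forall^\bullet_2)$: $\Sigma\{X,y;\Gamma\}_w\{\forall x\phi^\bullet\}_u\{\phi(y/x)^\bullet\}_v$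 / $\Sigma\{X;\Gamma\}_w\{\forall x\phi^\bullet\}_u$, where $w\leadsto u\leadsto v$, $y$ fresh [$u\leadsto v$, $y$ fresh]. $N_I$ consists of $(id),(\bot^\bullet)$ and the rules for $\lor,\land,\supset$ on propositional nested sequents. $N_{ND}$ consists of all rules except $(lin)$ on first-order nested sequents, and $N_{CD}$ likewise but with the side conditions in square brackets. $N_{GD}$, $N_{GN}$, $N_{GC}$ are $N_I$, $N_{ND}$, $N_{CD}$, respectively, together with $(lin)$. -/

import Mathlib

namespace NestedCalculi

/-! ## Nested sequents over an arbitrary type of component data -/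

/-- Labels; `0` is the label `w₀` of the root, the positive numbers label the nestings. -/
abbrev Lab := ℕ

/-- Polarized formulae: `inp φ` is the input formula `φ^•`, `out φ` the output formula `φ^∘`. -/
inductive Pol (F : Type) : Type
  | inp (φ : F) : Pol F
  | out (φ : F) : Pol F

/-- The input formula of a polarized formula, if it is one. -/
def Pol.input? {F : Type} : Pol F → Option F
  | .inp φ => some φ
  | .out _ => none

/-- The output formula of a polarized formula, if it is one. -/
def Pol.output? {F : Type} : Pol F → Option F
  | .inp _ => none
  | .out φ => some φ

/-- Nested sequents whose components carry data in `C`: `flat c` is a flat sequent, and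
`nest S w T` is `S, [T]_w`.  Thus `Γ, [Δ₁]_{w₁}, …, [Δₙ]_{wₙ}` is
`nest (… (nest (flat Γ) w₁ Δ₁) …) wₙ Δₙ`.  The order of the nestings is immaterial, see
`Nested.Perm`. -/
inductive Nested (C : Type) : Type
  | flat (c : C) : Nested C
  | nest (S : Nested C) (w : Lab) (T : Nested C) : Nested C

namespace Nested

variable {C : Type}

/-- The component at the root. -/
def root : Nested C → C
  | flat c => c
  | nest S _ _ => S.root

/-- The labels of the nestings at the root. -/
def topLabels : Nested C → List Lab
  | flat _ => []
  | nest S w _ => S.topLabels ++ [w]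

/-- The vertices of the tree of a nested sequent whose root is labelled `r`. -/
def nodesFrom (r : Lab) : Nested C → List (Lab × C)
  | flat c => [(r, c)]
  | nest S w T => S.nodesFrom r ++ T.nodesFrom w

/-- The edges of the tree of a nested sequent whose root is labelled `r`. -/
def edgesFrom (r : Lab) : Nested C → List (Lab × Lab)
  | flat _ => []
  | nest S w T => S.edgesFrom r ++ (r, w) :: T.edgesFrom w

/-- The vertices of the tree of `S` (with the root labelled `w₀`). -/
def nodes (S : Nested C) : List (Lab × C) := S.nodesFrom 0

/-- The edges of the tree of `S`. -/
def edges (S : Nested C) : List (Lab × Lab) := S.edgesFrom 0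

/-- All labels of `S`, including that of the root. -/
def labels (S : Nested C) : List Lab := S.nodes.map Prod.fst

/-- Every label occurs at most once (in particular the root label labels no nesting). -/
def UniqueLabels (S : Nested C) : Prop := S.labels.Nodup

/-- `u` is reachable from `w` in the tree of `S`. -/
def Reach (S : Nested C) (w u : Lab) : Prop :=
  w ∈ S.labels ∧ u ∈ S.labels ∧ Relation.ReflTransGen (fun a b => (a, b) ∈ S.edges) w u

/-- Identity of nested sequents as multisets: reordering of nestings at any depth. -/
inductive Perm : Nested C → Nested C → Prop
  | refl (S) : Perm S S
  | symm {S T} : Perm S T → Perm T S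
  | trans {S T U} : Perm S T → Perm T U → Perm S U
  | swap (S v T u U) : Perm (nest (nest S v T) u U) (nest (nest S u U) v T)
  | congr {S S₁ T T₁} (w) : Perm S S₁ → Perm T T₁ → Perm (nest S w T) (nest S₁ w T₁)

/-- Add data to the root component. -/
def addRoot [Add C] (c : C) : Nested C → Nested C
  | flat d => flat (d + c)
  | nest S w T => nest (S.addRoot c) w T

/-- The multiset union `S, D` of two nested sequents. -/
def merge [Add C] (S : Nested C) : Nested C → Nested C
  | flat c => S.addRoot c
  | nest D w T => nest (S.merge D) w T

/-- Put the data `D` at the `w`-component, for a label `w` of a nesting. -/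
def fillBelow [Add C] (w : Lab) (D : Nested C) : Nested C → Nested C
  | flat c => flat c
  | nest S v T => nest (fillBelow w D S) v (if v = w then T.merge D else fillBelow w D T)

/-- The nested sequent `S{D}_w`: the context `S` with the data `D` (formulae, signature and
nestings) put at its `w`-component; meaningful if `w` is a label of `S`. -/
def fill [Add C] (S : Nested C) (w : Lab) (D : Nested C) : Nested C :=
  if w = 0 then S.merge D else fillBelow w D S

/-- The nesting `[T]_w` as data to be put into a context. -/
def bracket [Zero C] (w : Lab) (T : Nested C) : Nested C := nest (flat 0) w T

end Nested

/-! ## Kripke frames -/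

/-- A non-empty set of worlds with a reflexive and transitive relation. -/
structure Frame where
  W : Type
  [nonempty : Nonempty W]
  [preorder : Preorder W]

attribute [instance] Frame.nonempty Frame.preorder

/-- The connectivity condition. -/
def Frame.Connected (F : Frame) : Prop := ∀ w u v : F.W, w ≤ u → w ≤ v → u ≤ v ∨ v ≤ u

/-! ## Propositional logics -/

/-- Propositional formulae. -/
inductive PForm : Type
  | var (p : ℕ) : PForm
  | bot : PForm
  | or (φ ψ : PForm) : PForm
  | and (φ ψ : PForm) : PForm
  | imp (φ ψ : PForm) : PForm

namespace PForm

/-- `⊤ := p ⊃ p` for a fixed propositional variable `p`. -/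
def top : PForm := imp (var 0) (var 0)

/-- Conjunction of a list of formulae. -/
def bigAnd : List PForm → PForm
  | [] => top
  | [φ] => φ
  | φ :: ψ :: l => and φ (bigAnd (ψ :: l))

/-- Disjunction of a list of formulae. -/
def bigOr : List PForm → PForm
  | [] => bot
  | [φ] => φ
  | φ :: ψ :: l => or φ (bigOr (ψ :: l))

end PForm

/-- Propositional Kripke models; `V p w` says that `p` holds at `w`. -/
structure PModel extends Frame where
  V : ℕ → W → Prop
  mono : ∀ p (w v : W), w ≤ v → V p w → V p v

/-- `M, w ⊩ φ`. -/
def PModel.Forces (M : PModel) : M.W → PForm → Prop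
  | w, .var p => M.V p w
  | _, .bot => False
  | w, .or φ ψ => M.Forces w φ ∨ M.Forces w ψ
  | w, .and φ ψ => M.Forces w φ ∧ M.Forces w ψ
  | w, .imp φ ψ => ∀ u : M.W, w ≤ u → M.Forces u φ → M.Forces u ψ

/-- Intuitionistic and Gödel-Dummett propositional logic. -/
inductive PLogic : Type
  | I : PLogic
  | GD : PLogic

/-- The models of the two propositional logics. -/
def PLogic.IsModel : PLogic → PModel → Prop
  | .I, _ => True
  | .GD, M => M.Connected

/-- `L`-validity of a formula. -/
def PForm.Valid (L : PLogic) (φ : PForm) : Prop :=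
  ∀ M : PModel, L.IsModel M → ∀ w : M.W, M.Forces w φ

/-- Propositional nested sequents: components are multisets of polarized formulae. -/
abbrev PSeq := Nested (Multiset (Pol PForm))

/-- A multiset of polarized formulae as a flat sequent. -/
def PSeq.of (Γ : Multiset (Pol PForm)) : PSeq := Nested.flat Γ

/-- The formula interpretation of a component `Γ` whose nestings have the interpretations `l`. -/
noncomputable def compInterp (Γ : Multiset (Pol PForm)) : List PForm → PForm
  | [] => .imp (.bigAnd (Γ.filterMap Pol.input?).toList) (.bigOr (Γ.filterMap Pol.output?).toList)
  | φ :: l => .imp (.bigAnd (Γ.filterMap Pol.input?).toList)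
      (.or (.bigOr (Γ.filterMap Pol.output?).toList) (.bigOr (φ :: l)))

/-- The formula interpretations of the nestings at the root. -/
noncomputable def PSeq.nestInterps : PSeq → List PForm
  | .flat _ => []
  | .nest S _ T => PSeq.nestInterps S ++ [compInterp T.root (PSeq.nestInterps T)]

/-- The formula interpretation of a nested sequent. -/
noncomputable def PSeq.interp (S : PSeq) : PForm := compInterp S.root (PSeq.nestInterps S)

/-- `L`-validity of a propositional nested sequent. -/
def PSeq.Valid (L : PLogic) (S : PSeq) : Prop := (PSeq.interp S).Valid L

open Nested Pol in
/-- Derivability in the nested calculi for `I` and `GD`.  In each rule `S` is the context with the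
active data removed.  Except for `lin`, putting the principal formulae back changes neither labels
nor edges, so side conditions on labels can be stated for `S` instead of the conclusion. -/
inductive PDerivable (L : PLogic) : PSeq → Prop
  -- nested sequents are multisets
  | exch {S T : PSeq} : S.Perm T → PDerivable L S → PDerivable L T
  | id (S : PSeq) (w u : Lab) (p : ℕ) : S.Reach w u →
      PDerivable L ((S.fill w (PSeq.of {inp (.var p)})).fill u (PSeq.of {out (.var p)}))
  | botIn (S : PSeq) (w : Lab) : w ∈ S.labels →
      PDerivable L (S.fill w (PSeq.of {inp .bot}))
  | orIn (S : PSeq) (w : Lab) (φ ψ : PForm) : w ∈ S.labels →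
      PDerivable L (S.fill w (PSeq.of {inp φ})) →
      PDerivable L (S.fill w (PSeq.of {inp ψ})) →
      PDerivable L (S.fill w (PSeq.of {inp (.or φ ψ)}))
  | orOut (S : PSeq) (w : Lab) (φ ψ : PForm) : w ∈ S.labels →
      PDerivable L (S.fill w (PSeq.of {out φ, out ψ})) →
      PDerivable L (S.fill w (PSeq.of {out (.or φ ψ)}))
  | andIn (S : PSeq) (w : Lab) (φ ψ : PForm) : w ∈ S.labels →
      PDerivable L (S.fill w (PSeq.of {inp φ, inp ψ})) →
      PDerivable L (S.fill w (PSeq.of {inp (.and φ ψ)}))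
  | andOut (S : PSeq) (w : Lab) (φ ψ : PForm) : w ∈ S.labels →
      PDerivable L (S.fill w (PSeq.of {out φ})) →
      PDerivable L (S.fill w (PSeq.of {out ψ})) →
      PDerivable L (S.fill w (PSeq.of {out (.and φ ψ)}))
  | impOut (S : PSeq) (w u : Lab) (φ ψ : PForm) : w ∈ S.labels → u ∉ S.labels →
      PDerivable L (S.fill w (bracket u (PSeq.of {inp φ, out ψ}))) →
      PDerivable L (S.fill w (PSeq.of {out (.imp φ ψ)}))
  | impIn (S : PSeq) (w u : Lab) (φ ψ : PForm) : S.Reach w u →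
      PDerivable L ((S.fill w (PSeq.of {inp (.imp φ ψ)})).fill u (PSeq.of {out φ})) →
      PDerivable L ((S.fill w (PSeq.of {inp (.imp φ ψ)})).fill u (PSeq.of {inp ψ})) →
      PDerivable L (S.fill w (PSeq.of {inp (.imp φ ψ)}))
  | lin (S : PSeq) (w v u : Lab) (Γ Δ : PSeq) : L = .GD → w ∈ S.labels →
      PDerivable L (S.fill w (bracket v (nest Γ u Δ))) →
      PDerivable L (S.fill w (bracket u (nest Δ v Γ))) →
      PDerivable L (S.fill w (nest (bracket v Γ) u Δ))

/-! ## First-order logics -/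

/-- Individual variables. -/
abbrev Var := ℕ

/-- Predicate symbols: denumerably many of each arity. -/
structure Pred where
  arity : ℕ
  index : ℕ

/-- First-order formulae. -/
inductive QForm : Type
  | atom (p : Pred) (xs : Fin p.arity → Var) : QForm
  | bot : QForm
  | or (φ ψ : QForm) : QForm
  | and (φ ψ : QForm) : QForm
  | imp (φ ψ : QForm) : QForm
  | ex (x : Var) (φ : QForm) : QForm
  | all (x : Var) (φ : QForm) : QForm

namespace QForm

/-- The free variables. -/
def free : QForm → Finset Var
  | atom _ xs => Finset.univ.image xs
  | bot => ∅
  | or φ ψ => φ.free ∪ ψ.free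
  | and φ ψ => φ.free ∪ ψ.free
  | imp φ ψ => φ.free ∪ ψ.free
  | ex x φ => φ.free.erase x
  | all x φ => φ.free.erase x

/-- All variables that occur, free or bound (a quantified variable counts as occurring). -/
def vars : QForm → Finset Var
  | atom _ xs => Finset.univ.image xs
  | bot => ∅
  | or φ ψ => φ.vars ∪ ψ.vars
  | and φ ψ => φ.vars ∪ ψ.vars
  | imp φ ψ => φ.vars ∪ ψ.vars
  | ex x φ => insert x φ.vars
  | all x φ => insert x φ.vars

/-- The bound variable to be used for `x` when the free variables of `Q x φ`, which form the set
`A`, are renamed by `σ`: it is `x` itself unless a renamed variable would be captured. -/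
def binder (σ : Var → Var) (x : Var) (A : Finset Var) : Var :=
  if x ∈ A.image σ then (A.image σ).sup (fun n => n) + 1 else x

/-- Capture-avoiding simultaneous renaming of free variables. -/
def rename : (Var → Var) → QForm → QForm
  | σ, atom p xs => atom p (fun i => σ (xs i))
  | _, bot => bot
  | σ, or φ ψ => or (φ.rename σ) (ψ.rename σ)
  | σ, and φ ψ => and (φ.rename σ) (ψ.rename σ)
  | σ, imp φ ψ => imp (φ.rename σ) (ψ.rename σ)
  | σ, ex x φ =>
      ex (binder σ x (φ.free.erase x))
        (φ.rename (Function.update σ x (binder σ x (φ.free.erase x))))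
  | σ, all x φ =>
      all (binder σ x (φ.free.erase x))
        (φ.rename (Function.update σ x (binder σ x (φ.free.erase x))))

/-- `φ(y/x)`: substitution of `y` for the free occurrences of `x`. -/
def subst (φ : QForm) (y x : Var) : QForm := φ.rename (Function.update (fun z => z) x y)

end QForm

/-- First-order Kripke models with nested domains; `U` is an ambient type containing all domains. -/
structure QModel extends Frame where
  U : Type
  D : W → Set U
  D_nonempty : ∀ w, (D w).Nonempty
  D_mono : ∀ w v : W, w ≤ v → D w ⊆ D v
  V : (p : Pred) → W → Set (Fin p.arity → U)
  V_sub : ∀ p w, ∀ a ∈ V p w, ∀ i, a i ∈ D w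
  V_mono : ∀ p (w v : W), w ≤ v → V p w ⊆ V p v

namespace QModel

/-- The constant domain condition. -/
def ConstantDomain (M : QModel) : Prop := ∀ w u : M.W, M.D w = M.D u

/-- `μ` takes its values in the union of all domains. -/
def IsAssignment (M : QModel) (μ : Var → M.U) : Prop := ∀ x, μ x ∈ ⋃ w, M.D w

/-- `M, w, μ ⊩ φ`. -/
def Forces (M : QModel) : M.W → (Var → M.U) → QForm → Prop
  | w, μ, .atom p xs => (fun i => μ (xs i)) ∈ M.V p w
  | _, _, .bot => False
  | w, μ, .or φ ψ => M.Forces w μ φ ∨ M.Forces w μ ψ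
  | w, μ, .and φ ψ => M.Forces w μ φ ∧ M.Forces w μ ψ
  | w, μ, .imp φ ψ => ∀ u : M.W, w ≤ u → M.Forces u μ φ → M.Forces u μ ψ
  | w, μ, .ex x φ => ∃ d ∈ M.D w, M.Forces w (Function.update μ x d) φ
  | w, μ, .all x φ => ∀ u : M.W, w ≤ u → ∀ d ∈ M.D u, M.Forces u (Function.update μ x d) φ

end QModel

/-- The four first-order logics. -/
inductive QLogic : Type
  | ND : QLogic
  | CD : QLogic
  | GN : QLogic
  | GC : QLogic

/-- The logics with constant domains. -/
def QLogic.IsConstant (L : QLogic) : Prop := L = .CD ∨ L = .GC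

/-- The first-order Gödel-Dummett logics. -/
def QLogic.IsGodel (L : QLogic) : Prop := L = .GN ∨ L = .GC

/-- The models of the four first-order logics. -/
def QLogic.IsModel (L : QLogic) (M : QModel) : Prop :=
  (L.IsConstant → M.ConstantDomain) ∧ (L.IsGodel → M.Connected)

/-- First-order nested sequents: a component is a signature together with a multiset of polarized
formulae. -/
abbrev QSeq := Nested (Multiset Var × Multiset (Pol QForm))

/-- The flat sequent `X; Γ`. -/
def QSeq.of (X : Multiset Var) (Γ : Multiset (Pol QForm)) : QSeq := Nested.flat (X, Γ)

/-- Satisfaction of the flat sequent `X; Γ` at the world `w`. -/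
def CompSat (M : QModel) (μ : Var → M.U) (w : M.W) (c : Multiset Var × Multiset (Pol QForm)) :
    Prop :=
  (∀ x ∈ c.1, μ x ∈ M.D w) → (∀ φ, Pol.inp φ ∈ c.2 → M.Forces w μ φ) →
    ∃ ψ, Pol.out ψ ∈ c.2 ∧ M.Forces w μ ψ

/-- Some nesting `[Δ]_v` at the root of the sequent is satisfied at `v`. -/
def NestSat (M : QModel) (ι : Lab → M.W) (μ : Var → M.U) : QSeq → Prop
  | .flat _ => False
  | .nest S v T => NestSat M ι μ S ∨
      ((∀ t ∈ T.topLabels, ι v ≤ ι t) → CompSat M μ (ι v) T.root ∨ NestSat M ι μ T)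

/-- `M, ι, μ, u ⊨ S`. -/
def QSeq.Sat (M : QModel) (ι : Lab → M.W) (μ : Var → M.U) (u : Lab) (S : QSeq) : Prop :=
  (∀ t ∈ S.topLabels, ι u ≤ ι t) → CompSat M μ (ι u) S.root ∨ NestSat M ι μ S

/-- `L`-validity of a first-order nested sequent. -/
def QSeq.Valid (L : QLogic) (S : QSeq) : Prop :=
  ∀ M : QModel, L.IsModel M → ∀ (ι : Lab → M.W) (μ : Var → M.U), M.IsAssignment μ →
    QSeq.Sat M ι μ 0 S

/-- The variable `x` is available for the label `w`. -/
def QSeq.Available (S : QSeq) (x : Var) (w : Lab) : Prop :=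
  ∃ u c, S.Reach u w ∧ (u, c) ∈ S.nodes ∧ x ∈ c.1

/-- The formula of a polarized formula. -/
def Pol.form {F : Type} : Pol F → F
  | .inp φ => φ
  | .out φ => φ

/-- The variable `y` does not occur in the nested sequent, neither in a signature nor in a
formula. -/
def QSeq.Fresh (S : QSeq) (y : Var) : Prop :=
  ∀ n ∈ S.nodes, y ∉ n.2.1 ∧ ∀ φ ∈ n.2.2, y ∉ φ.form.vars

open Nested Pol in
/-- Derivability in the nested calculi for `ND`, `CD`, `GN` and `GC`.  As in the propositional
case, `S` is the context with the active data removed; reachability and availability in `S` and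
in the conclusion are the same.  Freshness of a variable refers to the conclusion. -/
inductive QDerivable (L : QLogic) : QSeq → Prop
  -- nested sequents are multisets
  | exch {S T : QSeq} : S.Perm T → QDerivable L S → QDerivable L T
  | id (S : QSeq) (w u : Lab) (p : Pred) (xs : Fin p.arity → Var) : S.Reach w u →
      QDerivable L ((S.fill w (QSeq.of 0 {inp (.atom p xs)})).fill u (QSeq.of 0 {out (.atom p xs)}))
  | botIn (S : QSeq) (w : Lab) : w ∈ S.labels →
      QDerivable L (S.fill w (QSeq.of 0 {inp .bot}))
  | ds (S : QSeq) (w : Lab) (p : Pred) (xs : Fin p.arity → Var) : w ∈ S.labels →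
      QDerivable L (S.fill w (QSeq.of (Finset.univ.val.map xs) {inp (.atom p xs)})) →
      QDerivable L (S.fill w (QSeq.of 0 {inp (.atom p xs)}))
  | orIn (S : QSeq) (w : Lab) (φ ψ : QForm) : w ∈ S.labels →
      QDerivable L (S.fill w (QSeq.of 0 {inp φ})) →
      QDerivable L (S.fill w (QSeq.of 0 {inp ψ})) →
      QDerivable L (S.fill w (QSeq.of 0 {inp (.or φ ψ)}))
  | orOut (S : QSeq) (w : Lab) (φ ψ : QForm) : w ∈ S.labels →
      QDerivable L (S.fill w (QSeq.of 0 {out φ, out ψ})) →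
      QDerivable L (S.fill w (QSeq.of 0 {out (.or φ ψ)}))
  | andIn (S : QSeq) (w : Lab) (φ ψ : QForm) : w ∈ S.labels →
      QDerivable L (S.fill w (QSeq.of 0 {inp φ, inp ψ})) →
      QDerivable L (S.fill w (QSeq.of 0 {inp (.and φ ψ)}))
  | andOut (S : QSeq) (w : Lab) (φ ψ : QForm) : w ∈ S.labels →
      QDerivable L (S.fill w (QSeq.of 0 {out φ})) →
      QDerivable L (S.fill w (QSeq.of 0 {out ψ})) →
      QDerivable L (S.fill w (QSeq.of 0 {out (.and φ ψ)}))
  | impOut (S : QSeq) (w u : Lab) (φ ψ : QForm) : w ∈ S.labels → u ∉ S.labels →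
      QDerivable L (S.fill w (bracket u (QSeq.of 0 {inp φ, out ψ}))) →
      QDerivable L (S.fill w (QSeq.of 0 {out (.imp φ ψ)}))
  | impIn (S : QSeq) (w u : Lab) (φ ψ : QForm) : S.Reach w u →
      QDerivable L ((S.fill w (QSeq.of 0 {inp (.imp φ ψ)})).fill u (QSeq.of 0 {out φ})) →
      QDerivable L ((S.fill w (QSeq.of 0 {inp (.imp φ ψ)})).fill u (QSeq.of 0 {inp ψ})) →
      QDerivable L (S.fill w (QSeq.of 0 {inp (.imp φ ψ)}))
  | exOut1 (S : QSeq) (w : Lab) (x y : Var) (φ : QForm) : w ∈ S.labels →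
      (¬ L.IsConstant → QSeq.Available S y w) →
      QDerivable L (S.fill w (QSeq.of 0 {out (φ.subst y x), out (.ex x φ)})) →
      QDerivable L (S.fill w (QSeq.of 0 {out (.ex x φ)}))
  | exOut2 (S : QSeq) (w u : Lab) (x y : Var) (φ : QForm) : w ∈ S.labels → u ∈ S.labels →
      (¬ L.IsConstant → S.Reach w u) →
      QSeq.Fresh (S.fill u (QSeq.of 0 {out (.ex x φ)})) y →
      QDerivable L ((S.fill w (QSeq.of {y} 0)).fill u (QSeq.of 0 {out (φ.subst y x), out (.ex x φ)})) →
      QDerivable L (S.fill u (QSeq.of 0 {out (.ex x φ)}))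
  | exIn (S : QSeq) (w : Lab) (x y : Var) (φ : QForm) : w ∈ S.labels →
      QSeq.Fresh (S.fill w (QSeq.of 0 {inp (.ex x φ)})) y →
      QDerivable L (S.fill w (QSeq.of {y} {inp (φ.subst y x)})) →
      QDerivable L (S.fill w (QSeq.of 0 {inp (.ex x φ)}))
  | allOut (S : QSeq) (w u : Lab) (x y : Var) (φ : QForm) : w ∈ S.labels → u ∉ S.labels →
      QSeq.Fresh (S.fill w (QSeq.of 0 {out (.all x φ)})) y →
      QDerivable L (S.fill w (bracket u (QSeq.of {y} {out (φ.subst y x)}))) →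
      QDerivable L (S.fill w (QSeq.of 0 {out (.all x φ)}))
  | allIn1 (S : QSeq) (w u : Lab) (x y : Var) (φ : QForm) : S.Reach w u →
      (¬ L.IsConstant → QSeq.Available S y u) →
      QDerivable L ((S.fill w (QSeq.of 0 {inp (.all x φ)})).fill u (QSeq.of 0 {inp (φ.subst y x)})) →
      QDerivable L (S.fill w (QSeq.of 0 {inp (.all x φ)}))
  | allIn2 (S : QSeq) (w u v : Lab) (x y : Var) (φ : QForm) : w ∈ S.labels → S.Reach u v →
      (¬ L.IsConstant → S.Reach w u) →
      QSeq.Fresh (S.fill u (QSeq.of 0 {inp (.all x φ)})) y →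
      QDerivable L (((S.fill w (QSeq.of {y} 0)).fill u (QSeq.of 0 {inp (.all x φ)})).fill v
        (QSeq.of 0 {inp (φ.subst y x)})) →
      QDerivable L (S.fill u (QSeq.of 0 {inp (.all x φ)}))
  | lin (S : QSeq) (w v u : Lab) (Γ Δ : QSeq) : L.IsGodel → w ∈ S.labels →
      QDerivable L (S.fill w (bracket v (nest Γ u Δ))) →
      QDerivable L (S.fill w (bracket u (nest Δ v Γ))) →
      QDerivable L (S.fill w (nest (bracket v Γ) u Δ))

end NestedCalculi

/-!
The proof turns a failed search for a derivation into a countermodel.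

For the first-order calculi, let `S` be underivable. For every formula of `S`, some premise of the
corresponding rule instance is underivable as well (`QSeq.Und.step`), and it extends `S` except that
the analysed formula itself may be gone. In the Gödel logics, the rule `lin` moreover allows to
rearrange the tree of an underivable sequent into a chain (`QSeq.Und.linearize`): one of two sibling
nestings is put below the other, which only adds to the reachability relation. Repeating these
steps fairly produces a sequence of underivable sequents whose union satisfies the closure
conditions `QSeq.Hintikka` (`QSeq.Und.exists_hintikka`). No contraction or weakening is needed: a
formula stays until it is analysed.

The union is turned into a Kripke model whose worlds are the labels, ordered by reachability, and
whose domains consist of the available variables (`QSeq.Hintikka.model`). Input formulae are forced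
and output formulae are not (`QSeq.Hintikka.truth`), so the model refutes `S`. There are two
delicate points. A domain of available variables may be empty; but the rules for `∃` on the right
and `∀` on the left that introduce a variable at the root exclude this as soon as a formula has to
be instantiated, and otherwise the domains may be anything. Variables that are available nowhere
still have to denote something; an isolated world with all variables in its domain serves them.

The propositional calculi are reduced to the first-order ones. Propositional variables become
nullary predicates. A countermodel of the translation does not force the formula interpretation of
the sequent, and a first-order derivation of a sequent without quantifiers involves no quantifier
rule, so that it becomes a propositional derivation when signatures are forgotten
(`QDerivable.toP`).
-/

namespace NestedCalculi

namespace Nested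

/-! ### Trees of nested sequents -/

section Basic

variable {C : Type}

/-- The labels of the tree of a nested sequent whose root is labelled `r`. -/
def labelsFrom (r : Lab) (S : Nested C) : List Lab := (S.nodesFrom r).map Prod.fst

@[simp] theorem labelsFrom_flat (r : Lab) (c : C) : (flat c).labelsFrom r = [r] := rfl

@[simp] theorem labelsFrom_nest (r : Lab) (S : Nested C) (w : Lab) (T : Nested C) :
    (nest S w T).labelsFrom r = S.labelsFrom r ++ T.labelsFrom w := by
  simp [labelsFrom, nodesFrom]

theorem self_mem_labelsFrom (r : Lab) (S : Nested C) : r ∈ S.labelsFrom r := by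
  induction S <;> simp_all

theorem mem_labelsFrom {r l : Lab} {S : Nested C} :
    l ∈ S.labelsFrom r ↔ ∃ c, (l, c) ∈ S.nodesFrom r := by
  simp [labelsFrom]

theorem eq_of_mem_nodesFrom {r l : Lab} {S : Nested C} (hS : (S.labelsFrom r).Nodup) {c d : C}
    (hc : (l, c) ∈ S.nodesFrom r) (hd : (l, d) ∈ S.nodesFrom r) : c = d := by
  have := List.inj_on_of_nodup_map hS hc hd rfl
  simpa using this

theorem nodup_left {r : Lab} {S : Nested C} {w : Lab} {T : Nested C}
    (h : ((nest S w T).labelsFrom r).Nodup) : (S.labelsFrom r).Nodup := by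
  rw [labelsFrom_nest] at h
  exact h.of_append_left

theorem nodup_right {r : Lab} {S : Nested C} {w : Lab} {T : Nested C}
    (h : ((nest S w T).labelsFrom r).Nodup) : (T.labelsFrom w).Nodup := by
  rw [labelsFrom_nest] at h
  exact h.of_append_right

theorem notMem_right {r : Lab} {S : Nested C} {w : Lab} {T : Nested C}
    (h : ((nest S w T).labelsFrom r).Nodup) {l : Lab} (hl : l ∈ S.labelsFrom r) :
    l ∉ T.labelsFrom w := by
  rw [labelsFrom_nest] at h
  exact fun h' => List.disjoint_of_nodup_append h hl h'

theorem mem_labelsFrom_of_edge {r : Lab} {S : Nested C} {a b : Lab}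
    (h : (a, b) ∈ S.edgesFrom r) : a ∈ S.labelsFrom r ∧ b ∈ S.labelsFrom r := by
  induction S generalizing r with
  | flat c => simp [edgesFrom] at h
  | nest S w T ihS ihT =>
    simp only [edgesFrom, List.mem_append, List.mem_cons, Prod.mk.injEq] at h
    simp only [labelsFrom_nest, List.mem_append]
    rcases h with h | ⟨rfl, rfl⟩ | h
    · exact ⟨.inl (ihS h).1, .inl (ihS h).2⟩
    · exact ⟨.inl (self_mem_labelsFrom _ _), .inr (self_mem_labelsFrom _ _)⟩
    · exact ⟨.inr (ihT h).1, .inr (ihT h).2⟩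

/-- The reflexive transitive closure of the edges. -/
def Path (r : Lab) (S : Nested C) : Lab → Lab → Prop :=
  Relation.ReflTransGen (fun a b => (a, b) ∈ S.edgesFrom r)

theorem path_root {r : Lab} {S : Nested C} {l : Lab} (h : l ∈ S.labelsFrom r) :
    S.Path r r l := by
  induction S generalizing r with
  | flat c =>
    obtain rfl : l = r := by simpa using h
    exact .refl
  | nest S w T ihS ihT =>
    rw [labelsFrom_nest, List.mem_append] at h
    rcases h with h | h
    · exact Relation.ReflTransGen.mono (fun a b hab => by simp [edgesFrom, hab]) _ _ (ihS h)
    · refine Relation.ReflTransGen.head (b := w) (by simp [edgesFrom]) ?_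
      exact Relation.ReflTransGen.mono (fun a b hab => by simp [edgesFrom, hab]) _ _ (ihT h)

theorem reach_zero {S : Nested C} {l : Lab} (h : l ∈ S.labels) : S.Reach 0 l :=
  ⟨self_mem_labelsFrom 0 S, h, path_root h⟩

theorem reach_refl {S : Nested C} {l : Lab} (h : l ∈ S.labels) : S.Reach l l :=
  ⟨h, h, .refl⟩

theorem Reach.trans {S : Nested C} {a b c : Lab} (h : S.Reach a b) (h' : S.Reach b c) :
    S.Reach a c :=
  ⟨h.1, h'.2.1, h.2.2.trans h'.2.2⟩

theorem reach_of_edge {S : Nested C} {a b : Lab} (h : (a, b) ∈ S.edges) : S.Reach a b :=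
  ⟨(mem_labelsFrom_of_edge h).1, (mem_labelsFrom_of_edge h).2, .single h⟩

/-! ### Modifying a component -/

/-- Apply `f` to the components labelled `w` of a tree whose root is labelled `r`. -/
def modFrom (w : Lab) (f : C → C) : Lab → Nested C → Nested C
  | r, flat c => flat (if r = w then f c else c)
  | r, nest S v T => nest (modFrom w f r S) v (modFrom w f v T)

/-- Apply `f` to the component labelled `w`. -/
def mod (S : Nested C) (w : Lab) (f : C → C) : Nested C := modFrom w f 0 S

theorem nodesFrom_modFrom (w : Lab) (f : C → C) (r : Lab) (S : Nested C) :
    (modFrom w f r S).nodesFrom r =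
      (S.nodesFrom r).map fun n => (n.1, if n.1 = w then f n.2 else n.2) := by
  induction S generalizing r <;> simp_all [modFrom, nodesFrom]

theorem edgesFrom_modFrom (w : Lab) (f : C → C) (r : Lab) (S : Nested C) :
    (modFrom w f r S).edgesFrom r = S.edgesFrom r := by
  induction S generalizing r <;> simp_all [modFrom, edgesFrom]

theorem labelsFrom_modFrom (w : Lab) (f : C → C) (r : Lab) (S : Nested C) :
    (modFrom w f r S).labelsFrom r = S.labelsFrom r := by
  simp [labelsFrom, nodesFrom_modFrom, Function.comp_def]

@[simp] theorem labels_mod (S : Nested C) (w : Lab) (f : C → C) :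
    (S.mod w f).labels = S.labels := labelsFrom_modFrom w f 0 S

@[simp] theorem edges_mod (S : Nested C) (w : Lab) (f : C → C) :
    (S.mod w f).edges = S.edges := edgesFrom_modFrom w f 0 S

@[simp] theorem uniqueLabels_mod (S : Nested C) (w : Lab) (f : C → C) :
    (S.mod w f).UniqueLabels ↔ S.UniqueLabels := by
  simp [UniqueLabels]

@[simp] theorem reach_mod (S : Nested C) (w : Lab) (f : C → C) (a b : Lab) :
    (S.mod w f).Reach a b ↔ S.Reach a b := by
  simp [Reach]

theorem mem_nodes_mod (S : Nested C) (w : Lab) (f : C → C) (l : Lab) (c : C) :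
    (l, c) ∈ (S.mod w f).nodes ↔ ∃ d, (l, d) ∈ S.nodes ∧ c = if l = w then f d else d := by
  rw [nodes, mod, nodesFrom_modFrom]
  simp only [List.mem_map, Prod.exists, Prod.mk.injEq]
  constructor
  · rintro ⟨a, b, h, rfl, rfl⟩
    exact ⟨b, h, rfl⟩
  · rintro ⟨d, h, rfl⟩
    exact ⟨l, d, h, rfl, rfl⟩

theorem modFrom_congr {w : Lab} {f g : C → C} {r : Lab} {S : Nested C}
    (h : ∀ c, (w, c) ∈ S.nodesFrom r → f c = g c) : modFrom w f r S = modFrom w g r S := by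
  induction S generalizing r with
  | flat c =>
    by_cases hr : r = w
    · subst hr
      simp [modFrom, h c (by simp [nodesFrom])]
    · simp [modFrom, hr]
  | nest S v T ihS ihT =>
    simp only [modFrom]
    rw [ihS fun c hc => h c (by simp [nodesFrom, hc]), ihT fun c hc => h c (by simp [nodesFrom, hc])]

theorem modFrom_id (w : Lab) (r : Lab) (S : Nested C) : modFrom w id r S = S := by
  induction S generalizing r <;> simp_all [modFrom]

theorem modFrom_of_notMem {w : Lab} (f : C → C) {r : Lab} {S : Nested C}
    (h : w ∉ S.labelsFrom r) : modFrom w f r S = S := by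
  rw [modFrom_congr (g := id), modFrom_id]
  exact fun c hc => (h (mem_labelsFrom.2 ⟨c, hc⟩)).elim

theorem mod_mod (S : Nested C) (w : Lab) (f g : C → C) :
    (S.mod w f).mod w g = S.mod w (g ∘ f) := by
  suffices h : ∀ r, modFrom w g r (modFrom w f r S) = modFrom w (g ∘ f) r S from h 0
  intro r
  induction S generalizing r with
  | flat c => by_cases hr : r = w <;> simp [modFrom, hr]
  | nest S v T ihS ihT => simp [modFrom, ihS, ihT]

theorem mod_comm (S : Nested C) (w u : Lab) {f g : C → C} (h : ∀ c, f (g c) = g (f c)) :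
    (S.mod w f).mod u g = (S.mod u g).mod w f := by
  suffices h : ∀ r, modFrom u g r (modFrom w f r S) = modFrom w f r (modFrom u g r S) from h 0
  intro r
  induction S generalizing r with
  | flat c =>
    simp only [modFrom]
    split_ifs <;> simp [h]
  | nest S v T ihS ihT => simp [modFrom, ihS, ihT]

theorem mod_eq_self {S : Nested C} {w : Lab} {f : C → C}
    (h : ∀ c, (w, c) ∈ S.nodes → f c = c) : S.mod w f = S := by
  rw [mod, modFrom_congr (g := id) h, modFrom_id]

end Basic

/-! ### Putting data into a context -/

section Fill

variable {C : Type} [AddCommMonoid C]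

/-- `fill` for a tree whose root is labelled `r`. -/
def fillFrom (r : Lab) (S : Nested C) (w : Lab) (D : Nested C) : Nested C :=
  if w = r then S.merge D else fillBelow w D S

theorem fillBelow_of_notMem {w r : Lab} {D S : Nested C} (h : w ∉ S.labelsFrom r) :
    fillBelow w D S = S := by
  induction S generalizing r with
  | flat c => rfl
  | nest S v T ihS ihT =>
    simp only [labelsFrom_nest, List.mem_append, not_or] at h
    have hv : v ≠ w := fun hv => h.2 (hv ▸ self_mem_labelsFrom v T)
    simp [fillBelow, ihS h.1, ihT h.2, hv]

theorem merge_nest_left (S : Nested C) (t : Lab) (T D : Nested C) :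
    Perm ((nest S t T).merge D) (nest (S.merge D) t T) := by
  induction D with
  | flat c => exact .refl _
  | nest D v E ihD _ => exact (Perm.congr v ihD (.refl E)).trans (.swap _ _ _ _ _)

theorem fillFrom_nest_left {r w t : Lab} {S T : Nested C} (D : Nested C)
    (h : w ∉ T.labelsFrom t) :
    Perm (fillFrom r (nest S t T) w D) (nest (fillFrom r S w D) t T) := by
  by_cases hw : w = r
  · simpa [fillFrom, hw] using merge_nest_left S t T D
  · have ht : t ≠ w := fun ht => h (ht ▸ self_mem_labelsFrom t T)
    simp only [fillFrom, hw, if_false, fillBelow, ht, fillBelow_of_notMem h]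
    exact .refl _

theorem fillFrom_nest_right {r w t : Lab} {S T : Nested C} (D : Nested C)
    (h : w ∉ S.labelsFrom r) :
    fillFrom r (nest S t T) w D = nest S t (fillFrom t T w D) := by
  have hr : w ≠ r := fun hr => h (hr ▸ self_mem_labelsFrom r S)
  simp only [fillFrom, hr, if_false, fillBelow, fillBelow_of_notMem h]
  simp only [eq_comm]

@[simp] theorem addRoot_zero (S : Nested C) : S.addRoot 0 = S := by
  induction S <;> simp_all [addRoot]

/-- Adding a flat sequent to the `w`-component is a modification of that component. -/
theorem fill_flat {S : Nested C} (hS : S.UniqueLabels) (w : Lab) (d : C) :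
    S.fill w (flat d) = S.mod w (· + d) := by
  suffices h : ∀ r, (S.labelsFrom r).Nodup → fillFrom r S w (flat d) = modFrom w (· + d) r S from
    h 0 hS
  clear hS
  intro r hS
  by_cases hw : w = r
  · subst hw
    simp only [fillFrom, if_true, merge]
    induction S with
    | flat c => simp [modFrom, addRoot]
    | nest S v T ihS _ =>
      simp only [modFrom, addRoot, ihS (nodup_left hS)]
      rw [modFrom_of_notMem _ (notMem_right hS (self_mem_labelsFrom _ _))]
  · simp only [fillFrom, hw, if_false]
    induction S generalizing r with
    | flat c => simp [modFrom, fillBelow, Ne.symm hw]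
    | nest S v T ihS ihT =>
      simp only [modFrom, fillBelow, ihS r (nodup_left hS) hw]
      by_cases hv : w = v
      · subst hv
        have key : ∀ T : Nested C, (T.labelsFrom w).Nodup →
            T.merge (flat d) = modFrom w (· + d) w T := by
          intro T hT
          simp only [merge]
          clear ihT hS ihS
          induction T with
          | flat c => simp [modFrom, addRoot]
          | nest S v T ihS _ =>
            simp only [modFrom, addRoot, ihS (nodup_left hT)]
            rw [modFrom_of_notMem _ (notMem_right hT (self_mem_labelsFrom _ _))]
        simp [key T (nodup_right hS)]
      · simp [Ne.symm hv, ihT v (nodup_right hS) hv]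

theorem fillFrom_bracket {r w u : Lab} {S T : Nested C} (hS : (S.labelsFrom r).Nodup)
    (hw : w ∈ S.labelsFrom r) :
    ((fillFrom r S w (bracket u T)).nodesFrom r).Perm (S.nodesFrom r ++ T.nodesFrom u) ∧
    ((fillFrom r S w (bracket u T)).edgesFrom r).Perm
      (S.edgesFrom r ++ (w, u) :: T.edgesFrom u) := by
  by_cases hr : w = r
  · simp [fillFrom, hr, bracket, merge, nodesFrom, edgesFrom]
  · induction S generalizing r with
    | flat c => simp_all
    | nest S v E ihS ihE =>
      by_cases hwS : w ∈ S.labelsFrom r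
      · have hv : v ≠ w := by
          rintro rfl
          exact notMem_right hS hwS (self_mem_labelsFrom _ _)
        obtain ⟨h1, h2⟩ := ihS (nodup_left hS) hwS hr
        simp only [fillFrom, hr, if_false] at h1 h2 ⊢
        simp only [fillBelow, hv, if_false, fillBelow_of_notMem (notMem_right hS hwS), nodesFrom,
          edgesFrom]
        rw [← Multiset.coe_eq_coe] at h1 h2 ⊢
        rw [← Multiset.coe_eq_coe]
        simp only [← Multiset.coe_add, ← Multiset.cons_coe, ← Multiset.singleton_add] at h1 h2 ⊢
        rw [h1, h2]
        constructor <;> ac_rfl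
      · have hwE : w ∈ E.labelsFrom v := by simpa [hwS] using hw
        rw [fillFrom_nest_right _ hwS]
        simp only [nodesFrom, edgesFrom]
        have : ((fillFrom v E w (bracket u T)).nodesFrom v).Perm
              (E.nodesFrom v ++ T.nodesFrom u) ∧
            ((fillFrom v E w (bracket u T)).edgesFrom v).Perm
              (E.edgesFrom v ++ (w, u) :: T.edgesFrom u) := by
          by_cases hv : w = v
          · simp [fillFrom, hv, bracket, merge, nodesFrom, edgesFrom]
          · exact ihE (nodup_right hS) hwE hv
        obtain ⟨h1, h2⟩ := this
        rw [← Multiset.coe_eq_coe] at h1 h2 ⊢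
        rw [← Multiset.coe_eq_coe]
        simp only [← Multiset.coe_add, ← Multiset.cons_coe, ← Multiset.singleton_add] at h1 h2 ⊢
        rw [h1, h2]
        constructor <;> ac_rfl

theorem nodes_fill_bracket {w u : Lab} {S T : Nested C} (hS : S.UniqueLabels)
    (hw : w ∈ S.labels) :
    (S.fill w (bracket u T)).nodes.Perm (S.nodes ++ T.nodesFrom u) :=
  (fillFrom_bracket hS hw).1

theorem edges_fill_bracket {w u : Lab} {S T : Nested C} (hS : S.UniqueLabels)
    (hw : w ∈ S.labels) :
    (S.fill w (bracket u T)).edges.Perm (S.edges ++ (w, u) :: T.edgesFrom u) :=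
  (fillFrom_bracket hS hw).2

end Fill

/-! ### Linearization -/

section Linear

variable {C : Type}

/-- The two ways of putting one of two sibling nestings below the other, at any place of the
tree. -/
inductive LinStep : Nested C → Nested C → Nested C → Prop
  | base (S v Γ u Δ) : LinStep (nest (nest S v Γ) u Δ) (nest S v (nest Γ u Δ))
      (nest S u (nest Δ v Γ))
  | left {S S₁ S₂} (w T) : LinStep S S₁ S₂ → LinStep (nest S w T) (nest S₁ w T) (nest S₂ w T)
  | right {T T₁ T₂} (S w) : LinStep T T₁ T₂ → LinStep (nest S w T) (nest S w T₁) (nest S w T₂)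

/-- `LinStep S S₁ S₂` is an instance of the rule `lin` up to the order of the nestings. -/
theorem LinStep.exists_fill [AddCommMonoid C] {S S₁ S₂ : Nested C} (h : LinStep S S₁ S₂)
    {r : Lab} (hS : (S.labelsFrom r).Nodup) :
    ∃ (S₀ : Nested C) (w v u : Lab) (Γ Δ : Nested C),
      w ∈ S₀.labelsFrom r ∧ S₀.labelsFrom r ⊆ S.labelsFrom r ∧
      Perm (fillFrom r S₀ w (nest (bracket v Γ) u Δ)) S ∧
      Perm S₁ (fillFrom r S₀ w (bracket v (nest Γ u Δ))) ∧
      Perm S₂ (fillFrom r S₀ w (bracket u (nest Δ v Γ))) := by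
  induction h generalizing r with
  | base S v Γ u Δ =>
    refine ⟨S, r, v, u, Γ, Δ, self_mem_labelsFrom _ _, by simp, ?_, ?_, ?_⟩ <;>
      simpa [fillFrom, merge, bracket] using Perm.refl _
  | left t T _ ih =>
    obtain ⟨S₀, w, v, u, Γ, Δ, hw, hsub, h0, h1, h2⟩ := ih (nodup_left hS)
    have hT := notMem_right hS (hsub hw)
    refine ⟨nest S₀ t T, w, v, u, Γ, Δ, by simp [hw], ?_,
      (fillFrom_nest_left _ hT).trans (.congr t h0 (.refl T)),
      .trans (.congr t h1 (.refl T)) (fillFrom_nest_left _ hT).symm,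
      .trans (.congr t h2 (.refl T)) (fillFrom_nest_left _ hT).symm⟩
    simpa using List.subset_append_of_subset_left _ hsub
  | right S t _ ih =>
    obtain ⟨S₀, w, v, u, Γ, Δ, hw, hsub, h0, h1, h2⟩ := ih (nodup_right hS)
    have hT : w ∉ S.labelsFrom r := fun h => notMem_right hS h (hsub hw)
    refine ⟨nest S t S₀, w, v, u, Γ, Δ, by simp [hw], ?_, ?_⟩
    · simpa using List.subset_append_of_subset_right _ hsub
    simp only [fillFrom_nest_right _ hT]
    exact ⟨.congr t (.refl S) h0, .congr t (.refl S) h1, .congr t (.refl S) h2⟩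

theorem LinStep.nodes_perm {S S₁ S₂ : Nested C} (h : LinStep S S₁ S₂) (r : Lab) :
    (S₁.nodesFrom r).Perm (S.nodesFrom r) ∧ (S₂.nodesFrom r).Perm (S.nodesFrom r) := by
  induction h generalizing r with
  | base S v Γ u Δ =>
    simp only [nodesFrom, ← Multiset.coe_eq_coe, ← Multiset.coe_add]
    constructor <;> ac_rfl
  | left t T _ ih => exact ⟨(ih r).1.append_right _, (ih r).2.append_right _⟩
  | right S t _ ih => exact ⟨(ih t).1.append_left _, (ih t).2.append_left _⟩

theorem path_nest_left {r : Lab} {S : Nested C} {a b : Lab} (h : S.Path r a b) (w : Lab)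
    (T : Nested C) : (nest S w T).Path r a b :=
  Relation.ReflTransGen.mono (fun _ _ hab => by simp [edgesFrom, hab]) _ _ h

theorem path_nest_right {w : Lab} {T : Nested C} {a b : Lab} (h : T.Path w a b) (r : Lab)
    (S : Nested C) : (nest S w T).Path r a b :=
  Relation.ReflTransGen.mono (fun _ _ hab => by simp [edgesFrom, hab]) _ _ h

theorem path_nest_edge (r : Lab) (S : Nested C) (w : Lab) (T : Nested C) :
    (nest S w T).Path r r w :=
  .single (by simp [edgesFrom])

theorem LinStep.path_of_edge {S S₁ S₂ : Nested C} (h : LinStep S S₁ S₂) {r a b : Lab}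
    (hab : (a, b) ∈ S.edgesFrom r) : S₁.Path r a b ∧ S₂.Path r a b := by
  induction h generalizing r with
  | base S v Γ u Δ =>
    simp only [edgesFrom, List.mem_append, List.mem_cons, Prod.mk.injEq] at hab
    rcases hab with (hab | ⟨rfl, rfl⟩ | hab) | ⟨rfl, rfl⟩ | hab
    · exact ⟨.single (by simp [edgesFrom, hab]), .single (by simp [edgesFrom, hab])⟩
    · exact ⟨path_nest_edge _ _ _ _,
        (path_nest_edge _ _ _ _).trans (path_nest_right (path_nest_edge _ _ _ _) _ _)⟩
    · exact ⟨.single (by simp [edgesFrom, hab]), .single (by simp [edgesFrom, hab])⟩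
    · exact ⟨(path_nest_edge _ _ _ _).trans (path_nest_right (path_nest_edge _ _ _ _) _ _),
        path_nest_edge _ _ _ _⟩
    · exact ⟨.single (by simp [edgesFrom, hab]), .single (by simp [edgesFrom, hab])⟩
  | left t T _ ih =>
    simp only [edgesFrom, List.mem_append, List.mem_cons, Prod.mk.injEq] at hab
    rcases hab with hab | ⟨rfl, rfl⟩ | hab
    · exact ⟨path_nest_left (ih hab).1 _ _, path_nest_left (ih hab).2 _ _⟩
    · exact ⟨path_nest_edge _ _ _ _, path_nest_edge _ _ _ _⟩
    · exact ⟨path_nest_right (.single hab) _ _, path_nest_right (.single hab) _ _⟩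
  | right S t _ ih =>
    simp only [edgesFrom, List.mem_append, List.mem_cons, Prod.mk.injEq] at hab
    rcases hab with hab | ⟨rfl, rfl⟩ | hab
    · exact ⟨path_nest_left (.single hab) _ _, path_nest_left (.single hab) _ _⟩
    · exact ⟨path_nest_edge _ _ _ _, path_nest_edge _ _ _ _⟩
    · exact ⟨path_nest_right (ih hab).1 _ _, path_nest_right (ih hab).2 _ _⟩

/-- The number of components. -/
def size : Nested C → ℕ
  | flat _ => 1
  | nest S _ T => S.size + T.size

/-- The sum of the depths of the components.  Every `LinStep` increases it, and it is bounded by the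
square of the number of components, so linearization terminates. -/
def depthSum : Nested C → ℕ
  | flat _ => 0
  | nest S _ T => S.depthSum + T.depthSum + T.size

theorem size_pos (S : Nested C) : 0 < S.size := by
  induction S <;> simp_all [size]

theorem depthSum_le (S : Nested C) : S.depthSum ≤ S.size * S.size := by
  induction S with
  | flat c => simp [depthSum]
  | nest S w T ihS ihT =>
    simp only [depthSum, size]
    nlinarith [S.size_pos, T.size_pos]

theorem LinStep.measure {S S₁ S₂ : Nested C} (h : LinStep S S₁ S₂) :
    (S₁.size = S.size ∧ S.depthSum < S₁.depthSum) ∧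
      (S₂.size = S.size ∧ S.depthSum < S₂.depthSum) := by
  induction h with
  | base S v Γ u Δ =>
    have := Γ.size_pos
    have := Δ.size_pos
    simp only [size, depthSum]
    omega
  | left t T _ ih =>
    simp only [size, depthSum]
    omega
  | right S t _ ih =>
    simp only [size, depthSum]
    omega

/-- No component has more than one nesting, so the tree is a chain. -/
def IsChain : Nested C → Prop
  | flat _ => True
  | nest (flat _) _ T => T.IsChain
  | nest (nest _ _ _) _ _ => False

theorem exists_linStep {S : Nested C} (h : ¬ S.IsChain) : ∃ S₁ S₂, LinStep S S₁ S₂ := by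
  induction S with
  | flat c => exact (h trivial).elim
  | nest S w T ihS ihT =>
    cases S with
    | flat c =>
      obtain ⟨T₁, T₂, hT⟩ := ihT h
      exact ⟨_, _, hT.right _ w⟩
    | nest S v Γ => exact ⟨_, _, .base S v Γ w T⟩

theorem IsChain.path_total {S : Nested C} (h : S.IsChain) {r a b : Lab}
    (ha : a ∈ S.labelsFrom r) (hb : b ∈ S.labelsFrom r) : S.Path r a b ∨ S.Path r b a := by
  induction S generalizing r with
  | flat c =>
    obtain rfl : a = r := by simpa using ha
    exact .inr (path_root hb |>.head_induction_on .refl (by simp [edgesFrom]))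
  | nest S w T ihS ihT =>
    cases S with
    | nest S v Γ => exact h.elim
    | flat c =>
      simp only [labelsFrom_nest, labelsFrom_flat, List.singleton_append, List.mem_cons] at ha hb
      rcases ha with rfl | ha
      · exact .inl (path_root (by simpa using hb))
      rcases hb with rfl | hb
      · exact .inr (path_root (by simp [ha]))
      exact (ihT h ha hb).imp (path_nest_right · _ _) (path_nest_right · _ _)

/-- If a property of nested sequents with unique labels passes to one of the alternatives of each
`LinStep`, then a sequent with the property can be linearized. -/
theorem exists_isChain {P : Nested C → Prop}
    (hP : ∀ S S₁ S₂, S.UniqueLabels → LinStep S S₁ S₂ → P S → P S₁ ∨ P S₂)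
    (S : Nested C) (hS : S.UniqueLabels) (hPS : P S) :
    ∃ S', P S' ∧ S'.IsChain ∧ S'.nodes.Perm S.nodes ∧
      ∀ a b, (a, b) ∈ S.edges → S'.Path 0 a b := by
  induction hn : S.size * S.size - S.depthSum using Nat.strong_induction_on generalizing S with
  | _ n ih =>
    by_cases hc : S.IsChain
    · exact ⟨S, hPS, hc, .refl _, fun a b hab => .single hab⟩
    obtain ⟨S₁, S₂, h⟩ := exists_linStep hc
    obtain ⟨hm₁, hm₂⟩ := h.measure
    have key : ∀ T : Nested C, P T → T.size = S.size ∧ S.depthSum < T.depthSum →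
        (T.nodesFrom 0).Perm (S.nodesFrom 0) →
        (∀ a b, (a, b) ∈ S.edges → T.Path 0 a b) →
        ∃ S', P S' ∧ S'.IsChain ∧ S'.nodes.Perm S.nodes ∧
          ∀ a b, (a, b) ∈ S.edges → S'.Path 0 a b := by
      intro T hPT hm hp he
      have hlt : T.size * T.size - T.depthSum < n := by
        have := T.depthSum_le
        rw [hm.1] at this ⊢
        omega
      have hT : T.UniqueLabels := (hp.map Prod.fst).nodup_iff.2 hS
      obtain ⟨S', h1, h2, h3, h4⟩ := ih _ hlt T hT hPT rfl
      refine ⟨S', h1, h2, h3.trans hp, fun a b hab => ?_⟩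
      exact Relation.ReflTransGen.lift' id h4 _ _ (he a b hab)
    rcases hP S S₁ S₂ hS h hPS with h' | h'
    · exact key S₁ h' hm₁ (h.nodes_perm 0).1 fun a b hab => (h.path_of_edge hab).1
    · exact key S₂ h' hm₂ (h.nodes_perm 0).2 fun a b hab => (h.path_of_edge hab).2

end Linear

end Nested

/-! ### First-order formulae -/

namespace QForm

/-- The number of connectives and quantifiers. -/
def size : QForm → ℕ
  | atom _ _ => 0
  | bot => 0
  | or φ ψ => φ.size + ψ.size + 1
  | and φ ψ => φ.size + ψ.size + 1
  | imp φ ψ => φ.size + ψ.size + 1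
  | ex _ φ => φ.size + 1
  | all _ φ => φ.size + 1

@[simp] theorem size_rename (σ : Var → Var) (φ : QForm) : (φ.rename σ).size = φ.size := by
  induction φ generalizing σ <;> simp_all [size, rename]

@[simp] theorem size_subst (φ : QForm) (y x : Var) : (φ.subst y x).size = φ.size :=
  size_rename _ _

/-- The bound variable chosen by a renaming captures no renamed variable. -/
theorem binder_notMem (σ : Var → Var) (x : Var) (A : Finset Var) :
    binder σ x A ∉ A.image σ := by
  unfold binder
  split_ifs with h
  · intro h'
    exact Nat.not_succ_le_self _ (Finset.le_sup (f := fun n : Var => n) h')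
  · exact h

/-- An injective numbering of formulae. -/
def code : QForm → ℕ
  | atom p xs => Nat.pair 0 (Encodable.encode (p.index, List.ofFn xs))
  | bot => Nat.pair 1 0
  | or φ ψ => Nat.pair 2 (Nat.pair φ.code ψ.code)
  | and φ ψ => Nat.pair 3 (Nat.pair φ.code ψ.code)
  | imp φ ψ => Nat.pair 4 (Nat.pair φ.code ψ.code)
  | ex x φ => Nat.pair 5 (Nat.pair x φ.code)
  | all x φ => Nat.pair 6 (Nat.pair x φ.code)

theorem code_injective : Function.Injective code := by
  intro φ
  induction φ with
  | atom p xs =>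
    intro ψ h
    cases ψ with
    | atom q ys =>
      obtain ⟨n, i⟩ := p
      obtain ⟨m, j⟩ := q
      simp only [code, Nat.pair_eq_pair, Encodable.encode_inj, Prod.mk.injEq, true_and] at h
      obtain ⟨rfl, h⟩ := h
      obtain rfl : n = m := by simpa using congrArg List.length h
      rw [List.ofFn_inj.1 h]
    | _ => simp [code, Nat.pair_eq_pair] at h
  | bot =>
    intro ψ h
    cases ψ <;> simp_all [code, Nat.pair_eq_pair]
  | or φ₁ φ₂ ih₁ ih₂ | and φ₁ φ₂ ih₁ ih₂ | imp φ₁ φ₂ ih₁ ih₂ =>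
    intro ψ h
    cases ψ <;> simp [code, Nat.pair_eq_pair] at h
    rw [ih₁ h.1, ih₂ h.2]
  | ex x φ ih | all x φ ih =>
    intro ψ h
    cases ψ <;> simp [code, Nat.pair_eq_pair] at h
    rw [h.1, ih h.2]

instance : Countable QForm := code_injective.countable

end QForm

instance {F : Type} [Countable F] : Countable (Pol F) :=
  (Function.LeftInverse.injective (f := fun χ : Pol F => match χ with
      | .inp φ => (Sum.inl φ : F ⊕ F)
      | .out φ => Sum.inr φ)
    (g := Sum.elim Pol.inp Pol.out) (by rintro (φ | φ) <;> rfl)).countable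

namespace QModel

variable (M : QModel)

theorem forces_congr {w : M.W} {μ ν : Var → M.U} {φ : QForm} (h : ∀ x ∈ φ.free, μ x = ν x) :
    M.Forces w μ φ ↔ M.Forces w ν φ := by
  induction φ generalizing w μ ν with
  | atom p xs =>
    have : (fun i => μ (xs i)) = fun i => ν (xs i) :=
      funext fun i => h _ (by simp [QForm.free])
    simp [Forces, this]
  | bot => rfl
  | or φ ψ ih₁ ih₂ | and φ ψ ih₁ ih₂ =>
    simp only [QForm.free, Finset.mem_union] at h
    simp only [Forces, ih₁ fun x hx => h x (.inl hx), ih₂ fun x hx => h x (.inr hx)]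
  | imp φ ψ ih₁ ih₂ =>
    simp only [QForm.free, Finset.mem_union] at h
    simp only [Forces, fun u => ih₁ (w := u) fun x hx => h x (.inl hx),
      fun u => ih₂ (w := u) fun x hx => h x (.inr hx)]
  | ex x φ ih | all x φ ih =>
    have key : ∀ u d, M.Forces u (Function.update μ x d) φ ↔
        M.Forces u (Function.update ν x d) φ := by
      intro u d
      refine ih fun z hz => ?_
      by_cases hzx : z = x
      · simp [hzx]
      · simpa [hzx] using h z (by simp [QForm.free, hz, hzx])
    simp only [Forces, key]

theorem forces_rename {w : M.W} {μ : Var → M.U} {σ : Var → Var} {φ : QForm} :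
    M.Forces w μ (φ.rename σ) ↔ M.Forces w (μ ∘ σ) φ := by
  induction φ generalizing w μ σ with
  | atom p xs => rfl
  | bot => rfl
  | or φ ψ ih₁ ih₂ | and φ ψ ih₁ ih₂ | imp φ ψ ih₁ ih₂ => simp only [Forces, QForm.rename, ih₁, ih₂]
  | ex x φ ih | all x φ ih =>
    have hb := QForm.binder_notMem σ x (φ.free.erase x)
    set b := QForm.binder σ x (φ.free.erase x) with hbdef
    have key : ∀ u d, M.Forces u (Function.update μ b d) (φ.rename (Function.update σ x b)) ↔
        M.Forces u (Function.update (μ ∘ σ) x d) φ := by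
      intro u d
      rw [ih]
      refine M.forces_congr fun z hz => ?_
      by_cases hzx : z = x
      · simp [hzx]
      · have : σ z ≠ b := by
          intro hσ
          exact hb (hσ ▸ Finset.mem_image_of_mem _ (by simp [hz, hzx]))
        simp [hzx, this]
    simp only [Forces, QForm.rename, ← hbdef, key]

theorem forces_subst {w : M.W} {μ : Var → M.U} {φ : QForm} {x y : Var} :
    M.Forces w μ (φ.subst y x) ↔ M.Forces w (Function.update μ x (μ y)) φ := by
  rw [QForm.subst, forces_rename]
  refine M.forces_congr fun z _ => ?_
  by_cases hzx : z = x <;> simp [hzx]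

end QModel

open Nested Pol

namespace QSeq

/-! ### Extending underivable nested sequents -/

/-- The polarized formula `χ` occurs in the component of `S` labelled `w`. -/
def Mem (S : QSeq) (w : Lab) (χ : Pol QForm) : Prop := ∃ c, (w, c) ∈ S.nodes ∧ χ ∈ c.2

/-- The variable `x` belongs to the signature of the component of `S` labelled `w`. -/
def Sig (S : QSeq) (w : Lab) (x : Var) : Prop := ∃ c, (w, c) ∈ S.nodes ∧ x ∈ c.1

theorem Mem.label {S : QSeq} {w : Lab} {χ : Pol QForm} (h : S.Mem w χ) : w ∈ S.labels :=
  let ⟨c, hc, _⟩ := h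
  mem_labelsFrom.2 ⟨c, hc⟩

theorem available_iff {S : QSeq} {x : Var} {w : Lab} :
    S.Available x w ↔ ∃ u, S.Reach u w ∧ S.Sig u x :=
  ⟨fun ⟨u, c, h, h'⟩ => ⟨u, h, c, h'⟩, fun ⟨u, h, c, h'⟩ => ⟨u, c, h, h'⟩⟩

/-- `S'` contains all the data of `S`, except perhaps for formulae satisfying `P`. -/
structure Ext (P : Lab → Pol QForm → Prop) (S S' : QSeq) : Prop where
  reach : ∀ a b, S.Reach a b → S'.Reach a b
  sig : ∀ w x, S.Sig w x → S'.Sig w x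
  mem : ∀ w χ, S.Mem w χ → ¬ P w χ → S'.Mem w χ

theorem Ext.refl (P : Lab → Pol QForm → Prop) (S : QSeq) : Ext P S S :=
  ⟨fun _ _ h => h, fun _ _ h => h, fun _ _ h _ => h⟩

theorem Ext.trans {P : Lab → Pol QForm → Prop} {S S' S'' : QSeq} (h : Ext P S S')
    (h' : Ext P S' S'') : Ext P S S'' :=
  ⟨fun a b hab => h'.reach a b (h.reach a b hab), fun w x hx => h'.sig w x (h.sig w x hx),
    fun w χ hχ hP => h'.mem w χ (h.mem w χ hχ hP) hP⟩

theorem Ext.weaken {P Q : Lab → Pol QForm → Prop} {S S' : QSeq} (h : Ext P S S')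
    (hPQ : ∀ w χ, P w χ → Q w χ) : Ext Q S S' :=
  ⟨h.reach, h.sig, fun w χ hχ hQ => h.mem w χ hχ fun hP => hQ (hPQ w χ hP)⟩

theorem Ext.label {P : Lab → Pol QForm → Prop} {S S' : QSeq} (h : Ext P S S') {l : Lab}
    (hl : l ∈ S.labels) : l ∈ S'.labels :=
  (h.reach l l (reach_refl hl)).1

/-- No formula is excepted. -/
abbrev Nil : Lab → Pol QForm → Prop := fun _ _ => False

/-- Only the formula `χ` of the component labelled `w` is excepted. -/
abbrev Only (w : Lab) (χ : Pol QForm) : Lab → Pol QForm → Prop := fun l χ' => l = w ∧ χ' = χ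

/-- Every formula occurrence can be displayed: `S` is `S₀{χ}_w` for a context `S₀` that has the same
tree and the same signatures. -/
theorem exists_context {S : QSeq} (hS : S.UniqueLabels) {w : Lab} {χ : Pol QForm}
    (h : S.Mem w χ) : ∃ S₀ : QSeq, S₀.fill w (QSeq.of 0 {χ}) = S ∧ S₀.UniqueLabels ∧
      S₀.labels = S.labels ∧ S₀.edges = S.edges ∧ (∀ l x, S₀.Sig l x ↔ S.Sig l x) ∧
      Ext (Only w χ) S S₀ := by
  obtain ⟨⟨X, Γ⟩, hc, hχ⟩ := h
  obtain ⟨Γ', rfl⟩ := Multiset.exists_cons_of_mem hχ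
  have huniq : ∀ c, (w, c) ∈ S.nodes → c = (X, χ ::ₘ Γ') := fun c hc' =>
    eq_of_mem_nodesFrom hS hc' hc
  have hsig : ∀ l x, Sig (S.mod w fun _ => (X, Γ')) l x ↔ S.Sig l x := by
    intro l x
    simp only [Sig, mem_nodes_mod]
    constructor
    · rintro ⟨c, ⟨d, hd, rfl⟩, hx⟩
      split_ifs at hx with hl
      · subst hl
        exact ⟨_, hc, hx⟩
      · exact ⟨d, hd, hx⟩
    · rintro ⟨d, hd, hx⟩
      refine ⟨_, ⟨d, hd, rfl⟩, ?_⟩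
      split_ifs with hl
      · subst hl
        rw [huniq d hd] at hx
        exact hx
      · exact hx
  refine ⟨S.mod w fun _ => (X, Γ'), ?_, by simpa, by simp, by simp, hsig,
    fun a b => by simp, fun l x => (hsig l x).2, ?_⟩
  · rw [QSeq.of, fill_flat (by simpa), mod_mod]
    refine mod_eq_self fun c hc' => ?_
    rw [huniq c hc']
    simp [← Multiset.singleton_add, add_comm]
  · rintro l χ' ⟨d, hd, hχ'⟩ hne
    refine ⟨_, (mem_nodes_mod _ _ _ _ _).2 ⟨d, hd, rfl⟩, ?_⟩
    split_ifs with hl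
    · subst hl
      rw [huniq d hd] at hχ'
      simpa [show χ' ≠ χ from fun h => hne ⟨rfl, h⟩] using hχ'
    · exact hχ'

theorem ext_fill_flat {S : QSeq} (hS : S.UniqueLabels) {w : Lab} (hw : w ∈ S.labels)
    (X : Multiset Var) (Γ : Multiset (Pol QForm)) :
    (S.fill w (QSeq.of X Γ)).UniqueLabels ∧ Ext Nil S (S.fill w (QSeq.of X Γ)) ∧
      (∀ x ∈ X, Sig (S.fill w (QSeq.of X Γ)) w x) ∧
      ∀ χ ∈ Γ, Mem (S.fill w (QSeq.of X Γ)) w χ := by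
  obtain ⟨c, hc⟩ := mem_labelsFrom.1 hw
  rw [QSeq.of, fill_flat hS]
  refine ⟨by simpa, ⟨fun a b => by simp, ?_, ?_⟩, fun x hx => ?_, fun χ hχ => ?_⟩
  · rintro l x ⟨d, hd, hx⟩
    refine ⟨_, (mem_nodes_mod _ _ _ _ _).2 ⟨d, hd, rfl⟩, ?_⟩
    split_ifs <;> simp [hx]
  · rintro l χ ⟨d, hd, hx⟩ -
    refine ⟨_, (mem_nodes_mod _ _ _ _ _).2 ⟨d, hd, rfl⟩, ?_⟩
    split_ifs <;> simp [hx]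
  · exact ⟨_, (mem_nodes_mod _ _ _ _ _).2 ⟨c, hc, rfl⟩, by simp [hx]⟩
  · exact ⟨_, (mem_nodes_mod _ _ _ _ _).2 ⟨c, hc, rfl⟩, by simp [hχ]⟩

theorem ext_fill_bracket {S : QSeq} (hS : S.UniqueLabels) {w u : Lab} (hw : w ∈ S.labels)
    (hu : u ∉ S.labels) (X : Multiset Var) (Γ : Multiset (Pol QForm)) :
    (S.fill w (bracket u (QSeq.of X Γ))).UniqueLabels ∧
      Ext Nil S (S.fill w (bracket u (QSeq.of X Γ))) ∧
      (S.fill w (bracket u (QSeq.of X Γ))).Reach w u ∧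
      (∀ x ∈ X, Sig (S.fill w (bracket u (QSeq.of X Γ))) u x) ∧
      ∀ χ ∈ Γ, Mem (S.fill w (bracket u (QSeq.of X Γ))) u χ := by
  have hn := nodes_fill_bracket (T := QSeq.of X Γ) (u := u) hS hw
  have he := edges_fill_bracket (T := QSeq.of X Γ) (u := u) hS hw
  set S' := S.fill w (bracket u (QSeq.of X Γ))
  have hl : S'.labels.Perm (S.labels ++ [u]) := by
    simpa [labels, QSeq.of, nodesFrom] using hn.map Prod.fst
  have hu' : (u, (X, Γ)) ∈ S'.nodes := hn.mem_iff.2 (by simp [QSeq.of, nodesFrom])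
  refine ⟨hl.nodup_iff.2 (List.nodup_append.2 ⟨hS, by simp, ?_⟩), ⟨?_, ?_, ?_⟩,
    reach_of_edge (he.mem_iff.2 (by simp)), fun x hx => ⟨_, hu', hx⟩, fun χ hχ => ⟨_, hu', hχ⟩⟩
  · rintro a ha b hb rfl
    exact hu (by simp_all)
  · rintro a b ⟨ha, hb, hab⟩
    exact ⟨hl.mem_iff.2 (by simp [ha]), hl.mem_iff.2 (by simp [hb]),
      Relation.ReflTransGen.mono (fun _ _ h => he.mem_iff.2 (by simp [h])) _ _ hab⟩
  · rintro l x ⟨d, hd, hx⟩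
    exact ⟨d, hn.mem_iff.2 (by simp [hd]), hx⟩
  · rintro l x ⟨d, hd, hx⟩ -
    exact ⟨d, hn.mem_iff.2 (by simp [hd]), hx⟩

theorem exists_fresh (S : QSeq) : ∃ y, S.Fresh y := by
  have hfin : Set.Finite (⋃ n ∈ {n | n ∈ S.nodes}, ({y | y ∈ n.2.1} ∪
      ⋃ χ ∈ {χ | χ ∈ n.2.2}, {y | y ∈ χ.form.vars})) := by
    refine (List.finite_toSet _).biUnion fun n _ => ?_
    refine (Multiset.finite_toSet _).union ?_
    exact (Multiset.finite_toSet _).biUnion fun χ _ => Finset.finite_toSet _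
  obtain ⟨y, hy⟩ := hfin.exists_notMem
  simp only [Set.mem_ofPred_eq, Set.mem_iUnion, Set.mem_union, not_exists, not_or] at hy
  exact ⟨y, fun n hn => ⟨(hy n hn).1, fun χ hχ => (hy n hn).2 χ hχ⟩⟩

theorem exists_fresh_label (S : QSeq) : ∃ u, u ∉ S.labels :=
  (List.finite_toSet S.labels).exists_notMem

/-- `S` has unique labels and is not derivable. -/
structure Und (L : QLogic) (S : QSeq) : Prop where
  unique : S.UniqueLabels
  not_derivable : ¬ QDerivable L S

/-- The polarized formulae that the rules analyse without keeping a copy. -/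
def Transient : Pol QForm → Prop
  | inp (.or _ _) | inp (.and _ _) | inp (.ex _ _) => True
  | out (.or _ _) | out (.and _ _) | out (.imp _ _) | out (.all _ _) => True
  | _ => False

/-- What the rule for the formula `χ` of the `w`-component of `S`, applied with the label `u` and
the variable `y` where the rule has such parameters, contributes to the premise `S'`.  For the
formulae that get instantiated by all available variables, this includes that there is such a
variable. -/
def Done (L : QLogic) (S S' : QSeq) (w : Lab) (u : Lab) (y : Var) : Pol QForm → Prop
  | inp (.atom _ xs) => ∀ i, S'.Sig w (xs i)
  | inp .bot => False
  | inp (.or φ ψ) => S'.Mem w (inp φ) ∨ S'.Mem w (inp ψ)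
  | inp (.and φ ψ) => S'.Mem w (inp φ) ∧ S'.Mem w (inp ψ)
  | inp (.imp φ ψ) => S.Reach w u → S'.Mem u (out φ) ∨ S'.Mem u (inp ψ)
  | inp (.ex x φ) => ∃ y, S'.Sig w y ∧ S'.Mem w (inp (φ.subst y x))
  | inp (.all x φ) => (∃ z, S'.Sig 0 z) ∧
      (S.Reach w u → (¬ L.IsConstant → S.Available y u) → S'.Mem u (inp (φ.subst y x)))
  | out (.atom _ _) => True
  | out .bot => True
  | out (.or φ ψ) => S'.Mem w (out φ) ∧ S'.Mem w (out ψ)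
  | out (.and φ ψ) => S'.Mem w (out φ) ∨ S'.Mem w (out ψ)
  | out (.imp φ ψ) => ∃ u, S'.Reach w u ∧ S'.Mem u (inp φ) ∧ S'.Mem u (out ψ)
  | out (.ex x φ) => (∃ z, S'.Sig 0 z) ∧
      ((¬ L.IsConstant → S.Available y w) → S'.Mem w (out (φ.subst y x)))
  | out (.all x φ) => ∃ u y, S'.Reach w u ∧ S'.Sig u y ∧ S'.Mem u (out (φ.subst y x))

variable {L : QLogic}

/-- An underivable nested sequent is not an instance of `id`. -/
theorem Und.not_id {S : QSeq} (hS : Und L S) {w u : Lab} {p : Pred} {xs : Fin p.arity → Var}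
    (hw : S.Mem w (inp (.atom p xs))) (hu : S.Mem u (out (.atom p xs))) : ¬ S.Reach w u := by
  intro hwu
  obtain ⟨S₁, rfl, h₁, hl₁, he₁, -, hext⟩ := exists_context hS.unique hu
  obtain ⟨S₀, rfl, h₀, hl₀, he₀, -, -⟩ := exists_context h₁ (hext.mem _ _ hw (by simp))
  have := hS.not_derivable
  exact this (.id S₀ w u p xs (by simpa [Reach, hl₀, he₀, hl₁, he₁] using hwu))

/-- Replacement of a displayed formula by formulae and variables. -/
theorem Und.replace {S S₀ : QSeq} {w : Lab} {χ : Pol QForm} (h₀ : S₀.UniqueLabels)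
    (hw : w ∈ S₀.labels) (hext : Ext (Only w χ) S S₀) {X : Multiset Var}
    {Γ : Multiset (Pol QForm)} (h : ¬ QDerivable L (S₀.fill w (QSeq.of X Γ))) :
    ∃ S', Und L S' ∧ Ext (Only w χ) S S' ∧ (∀ x ∈ X, S'.Sig w x) ∧ ∀ χ ∈ Γ, S'.Mem w χ := by
  obtain ⟨h1, h2, h3, h4⟩ := ext_fill_flat h₀ hw X Γ
  exact ⟨_, ⟨h1, h⟩, hext.trans (h2.weaken (by simp)), h3, h4⟩

/-- Replacement of a displayed formula by a new nesting. -/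
theorem Und.replace_bracket {S S₀ : QSeq} {w u : Lab} {χ : Pol QForm} (h₀ : S₀.UniqueLabels)
    (hw : w ∈ S₀.labels) (hu : u ∉ S₀.labels) (hext : Ext (Only w χ) S S₀) {X : Multiset Var}
    {Γ : Multiset (Pol QForm)} (h : ¬ QDerivable L (S₀.fill w (bracket u (QSeq.of X Γ)))) :
    ∃ S', Und L S' ∧ Ext (Only w χ) S S' ∧ S'.Reach w u ∧ (∀ x ∈ X, S'.Sig u x) ∧
      ∀ χ ∈ Γ, S'.Mem u χ := by
  obtain ⟨h1, h2, h3, h4, h5⟩ := ext_fill_bracket h₀ hw hu X Γ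
  exact ⟨_, ⟨h1, h⟩, hext.trans (h2.weaken (by simp)), h3, h4, h5⟩

/-- Addition of flat data to a component. -/
theorem Und.add {S : QSeq} (hS : S.UniqueLabels) {u : Lab} (hu : u ∈ S.labels) {X : Multiset Var}
    {Γ : Multiset (Pol QForm)} (h : ¬ QDerivable L (S.fill u (QSeq.of X Γ))) :
    ∃ S', Und L S' ∧ Ext Nil S S' ∧ (∀ x ∈ X, S'.Sig u x) ∧ ∀ χ ∈ Γ, S'.Mem u χ := by
  obtain ⟨h1, h2, h3, h4⟩ := ext_fill_flat hS hu X Γ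
  exact ⟨_, ⟨h1, h⟩, h2, h3, h4⟩

/-- The order in which flat data are put into a context is immaterial. -/
theorem fill_flat_comm {S : QSeq} (hS : S.UniqueLabels) (w u : Lab)
    (c d : Multiset Var × Multiset (Pol QForm)) :
    (S.fill w (flat c)).fill u (flat d) = (S.fill u (flat d)).fill w (flat c) := by
  rw [fill_flat hS, fill_flat hS, fill_flat (by simpa), fill_flat (by simpa),
    mod_comm _ _ _ fun e => add_right_comm e d c]

theorem fill_flat_add {S : QSeq} (hS : S.UniqueLabels) (w : Lab)
    (c d : Multiset Var × Multiset (Pol QForm)) :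
    (S.fill w (flat c)).fill w (flat d) = S.fill w (flat (c + d)) := by
  rw [fill_flat hS, fill_flat hS, fill_flat (by simpa), mod_mod]
  simp [Function.comp_def, add_assoc]

/-- An underivable nested sequent that contains a formula to be instantiated can be given a
variable in the signature of its root. -/
theorem Und.step_root {S : QSeq} (hS : Und L S) {w : Lab} {x : Var} {φ : QForm} :
    (S.Mem w (out (.ex x φ)) → ∃ S', Und L S' ∧ Ext Nil S S' ∧ ∃ z, S'.Sig 0 z) ∧
    (S.Mem w (inp (.all x φ)) → ∃ S', Und L S' ∧ Ext Nil S S' ∧ ∃ z, S'.Sig 0 z) := by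
  obtain ⟨y, hy⟩ := S.exists_fresh
  have key : ∀ χ, ¬ QDerivable L ((S.fill w (QSeq.of 0 {χ})).fill 0 (QSeq.of {y} 0)) →
      w ∈ S.labels → ∃ S', Und L S' ∧ Ext Nil S S' ∧ ∃ z, S'.Sig 0 z := by
    intro χ h hw
    obtain ⟨h1, h2, -, -⟩ := ext_fill_flat hS.unique hw 0 {χ}
    obtain ⟨S', h3, h4, h5, -⟩ := Und.add h1 (h2.label (self_mem_labelsFrom 0 S)) h
    exact ⟨S', h3, h2.trans h4, y, h5 y (by simp)⟩
  constructor
  · intro h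
    refine key (out (φ.subst y x)) (fun hd => hS.not_derivable ?_) h.label
    obtain ⟨S₀, rfl, h₀, hl, he, -, -⟩ := exists_context hS.unique h
    have h00 : (0 : Lab) ∈ S₀.labels := self_mem_labelsFrom 0 S₀
    have hw₀ : w ∈ S₀.labels := by simpa [hl] using h.label
    refine .exOut2 S₀ 0 w x y φ h00 hw₀ (fun _ => reach_zero hw₀) hy ?_
    convert hd using 1
    simp only [QSeq.of]
    rw [fill_flat_comm h₀, fill_flat_add h₀, Multiset.pair_comm]
    simp
  · intro h
    refine key (inp (φ.subst y x)) (fun hd => hS.not_derivable ?_) h.label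
    obtain ⟨S₀, rfl, h₀, hl, he, -, -⟩ := exists_context hS.unique h
    have h00 : (0 : Lab) ∈ S₀.labels := self_mem_labelsFrom 0 S₀
    have hw₀ : w ∈ S₀.labels := by simpa [hl] using h.label
    refine .allIn2 S₀ 0 w w x y φ h00 (reach_refl hw₀) (fun _ => reach_zero hw₀) hy ?_
    convert hd using 1
    simp only [QSeq.of]
    rw [fill_flat_comm h₀, fill_flat_comm]
    exact (ext_fill_flat h₀ hw₀ _ _).1

/-- Every formula of an underivable nested sequent can be analysed. -/
theorem Und.step {S : QSeq} (hS : Und L S) {w : Lab} {χ : Pol QForm} (h : S.Mem w χ) (u : Lab)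
    (y : Var) : ∃ S', Und L S' ∧ Ext (fun l χ' => Only w χ l χ' ∧ Transient χ) S S' ∧
      Done L S S' w u y χ := by
  have hnd := hS.not_derivable
  have hw := h.label
  obtain ⟨S₀, hfill, h₀, hl, he, hsig, hext⟩ := exists_context hS.unique h
  have hw₀ : w ∈ S₀.labels := hl ▸ hw
  have hreach : ∀ a b, S₀.Reach a b ↔ S.Reach a b := fun a b => by simp [Reach, hl, he]
  have havail : ∀ z a, S₀.Available z a ↔ S.Available z a := fun z a => by
    simp only [available_iff, hreach, hsig]
  -- the parameters of the rules that introduce a label or a variable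
  obtain ⟨v, hv⟩ := S₀.exists_fresh_label
  obtain ⟨z, hz⟩ := S.exists_fresh
  match χ with
  | inp (.atom p xs) =>
    have := mt (QDerivable.ds S₀ w p xs hw₀) (hfill ▸ hnd)
    have heq : S₀.fill w (QSeq.of (Finset.univ.val.map xs) {inp (.atom p xs)}) =
        S.fill w (QSeq.of (Finset.univ.val.map xs) 0) := by
      rw [← hfill, QSeq.of, QSeq.of, QSeq.of, fill_flat_add h₀]
      simp
    rw [heq] at this
    obtain ⟨S', h1, h2, h3, -⟩ := Und.add hS.unique hw this
    exact ⟨S', h1, h2.weaken (by simp), fun i => h3 _ (by simp)⟩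
  | inp .bot => exact (hnd (hfill ▸ .botIn S₀ w hw₀)).elim
  | inp (.or φ ψ) =>
    by_cases hφ : QDerivable L (S₀.fill w (QSeq.of 0 {inp φ}))
    · have hψ := mt (QDerivable.orIn S₀ w φ ψ hw₀ hφ) (hfill ▸ hnd)
      obtain ⟨S', h1, h2, -, h4⟩ := Und.replace h₀ hw₀ hext hψ
      exact ⟨S', h1, h2.weaken (by simp [Transient]), .inr (h4 _ (by simp))⟩
    · obtain ⟨S', h1, h2, -, h4⟩ := Und.replace h₀ hw₀ hext hφ
      exact ⟨S', h1, h2.weaken (by simp [Transient]), .inl (h4 _ (by simp))⟩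
  | inp (.and φ ψ) =>
    obtain ⟨S', h1, h2, -, h4⟩ := Und.replace h₀ hw₀ hext
      (mt (QDerivable.andIn S₀ w φ ψ hw₀) (hfill ▸ hnd))
    exact ⟨S', h1, h2.weaken (by simp [Transient]), h4 _ (by simp), h4 _ (by simp)⟩
  | inp (.imp φ ψ) =>
    by_cases hwu : S.Reach w u
    · have hrule := QDerivable.impIn S₀ w u φ ψ ((hreach w u).2 hwu) (L := L)
      rw [hfill] at hrule
      by_cases hφ : QDerivable L (S.fill u (QSeq.of 0 {out φ}))
      · obtain ⟨S', h1, h2, -, h4⟩ := Und.add hS.unique hwu.2.1 (mt (hrule hφ) hnd)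
        exact ⟨S', h1, h2.weaken (by simp), fun _ => .inr (h4 _ (by simp))⟩
      · obtain ⟨S', h1, h2, -, h4⟩ := Und.add hS.unique hwu.2.1 hφ
        exact ⟨S', h1, h2.weaken (by simp), fun _ => .inl (h4 _ (by simp))⟩
    · exact ⟨S, hS, .refl _ _, fun h' => (hwu h').elim⟩
  | inp (.ex x φ) =>
    obtain ⟨S', h1, h2, h3, h4⟩ := Und.replace h₀ hw₀ hext
      (mt (QDerivable.exIn S₀ w x z φ hw₀ (hfill ▸ hz)) (hfill ▸ hnd))
    exact ⟨S', h1, h2.weaken (by simp [Transient]), z, h3 _ (by simp), h4 _ (by simp)⟩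
  | inp (.all x φ) =>
    have key : ∃ S', Und L S' ∧ Ext Nil S S' ∧
        (S.Reach w u → (¬ L.IsConstant → S.Available y u) → S'.Mem u (inp (φ.subst y x))) := by
      by_cases hwu : S.Reach w u ∧ (¬ L.IsConstant → S.Available y u)
      · have hrule := QDerivable.allIn1 S₀ w u x y φ ((hreach w u).2 hwu.1)
          (fun hc => (havail y u).2 (hwu.2 hc))
        rw [hfill] at hrule
        obtain ⟨S', h1, h2, -, h4⟩ := Und.add hS.unique hwu.1.2.1 (mt hrule hnd)
        exact ⟨S', h1, h2, fun _ _ => h4 _ (by simp)⟩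
      · exact ⟨S, hS, .refl _ _, fun h' h'' => (hwu ⟨h', h''⟩).elim⟩
    obtain ⟨S', h1, h2, h3⟩ := key
    obtain ⟨S'', h1', h2', h3'⟩ := h1.step_root.2 (h2.mem _ _ h id)
    exact ⟨S'', h1', (h2.trans h2').weaken (by simp), h3',
      fun h' h'' => h2'.mem _ _ (h3 h' h'') id⟩
  | out (.atom p xs) => exact ⟨S, hS, .refl _ _, trivial⟩
  | out .bot => exact ⟨S, hS, .refl _ _, trivial⟩
  | out (.or φ ψ) =>
    obtain ⟨S', h1, h2, -, h4⟩ := Und.replace h₀ hw₀ hext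
      (mt (QDerivable.orOut S₀ w φ ψ hw₀) (hfill ▸ hnd))
    exact ⟨S', h1, h2.weaken (by simp [Transient]), h4 _ (by simp), h4 _ (by simp)⟩
  | out (.and φ ψ) =>
    by_cases hφ : QDerivable L (S₀.fill w (QSeq.of 0 {out φ}))
    · have hψ := mt (QDerivable.andOut S₀ w φ ψ hw₀ hφ) (hfill ▸ hnd)
      obtain ⟨S', h1, h2, -, h4⟩ := Und.replace h₀ hw₀ hext hψ
      exact ⟨S', h1, h2.weaken (by simp [Transient]), .inr (h4 _ (by simp))⟩
    · obtain ⟨S', h1, h2, -, h4⟩ := Und.replace h₀ hw₀ hext hφ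
      exact ⟨S', h1, h2.weaken (by simp [Transient]), .inl (h4 _ (by simp))⟩
  | out (.imp φ ψ) =>
    obtain ⟨S', h1, h2, h3, -, h4⟩ := Und.replace_bracket h₀ hw₀ hv hext
      (mt (QDerivable.impOut S₀ w v φ ψ hw₀ hv) (hfill ▸ hnd))
    exact ⟨S', h1, h2.weaken (by simp [Transient]), v, h3, h4 _ (by simp), h4 _ (by simp)⟩
  | out (.ex x φ) =>
    have key : ∃ S', Und L S' ∧ Ext Nil S S' ∧
        ((¬ L.IsConstant → S.Available y w) → S'.Mem w (out (φ.subst y x))) := by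
      by_cases hy : ¬ L.IsConstant → S.Available y w
      · have hrule := QDerivable.exOut1 S₀ w x y φ hw₀ fun hc => (havail y w).2 (hy hc)
        have heq : S₀.fill w (QSeq.of 0 {out (φ.subst y x), out (.ex x φ)}) =
            S.fill w (QSeq.of 0 {out (φ.subst y x)}) := by
          rw [← hfill, QSeq.of, QSeq.of, QSeq.of, fill_flat_add h₀, Multiset.pair_comm]
          simp
        rw [hfill, heq] at hrule
        obtain ⟨S', h1, h2, -, h4⟩ := Und.add hS.unique hw (mt hrule hnd)
        exact ⟨S', h1, h2, fun _ => h4 _ (by simp)⟩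
      · exact ⟨S, hS, .refl _ _, fun h' => (hy h').elim⟩
    obtain ⟨S', h1, h2, h3⟩ := key
    obtain ⟨S'', h1', h2', h3'⟩ := h1.step_root.1 (h2.mem _ _ h id)
    exact ⟨S'', h1', (h2.trans h2').weaken (by simp), h3', fun h' => h2'.mem _ _ (h3 h') id⟩
  | out (.all x φ) =>
    obtain ⟨S', h1, h2, h3, h4, h5⟩ := Und.replace_bracket h₀ hw₀ hv hext
      (mt (QDerivable.allOut S₀ w v x z φ hw₀ hv (hfill ▸ hz)) (hfill ▸ hnd))
    exact ⟨S', h1, h2.weaken (by simp [Transient]), v, z, h3, h4 _ (by simp), h5 _ (by simp)⟩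

/-- In the calculi with `lin`, an underivable nested sequent can be extended so that reachability
becomes total. -/
theorem Und.linearize {S : QSeq} (hS : Und L S) (hL : L.IsGodel) :
    ∃ S', Und L S' ∧ Ext Nil S S' ∧
      ∀ a ∈ S.labels, ∀ b ∈ S.labels, S'.Reach a b ∨ S'.Reach b a := by
  obtain ⟨S', h1, h2, h3, h4⟩ := exists_isChain (P := fun T : QSeq => ¬ QDerivable L T)
    (by
      intro T T₁ T₂ hT hstep hnd
      by_contra! hcon
      obtain ⟨S₀, w, v, u, Γ, Δ, hw, -, h0, h1, h2⟩ := hstep.exists_fill hT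
      exact hnd (.exch h0 (.lin S₀ w v u Γ Δ hL hw (.exch h1 hcon.1) (.exch h2 hcon.2))))
    S hS.unique hS.not_derivable
  have hl : S'.labels.Perm S.labels := h3.map Prod.fst
  refine ⟨S', ⟨hl.nodup_iff.2 hS.unique, h1⟩, ⟨?_, ?_, ?_⟩, ?_⟩
  · rintro a b ⟨ha, hb, hab⟩
    exact ⟨hl.mem_iff.2 ha, hl.mem_iff.2 hb, Relation.ReflTransGen.lift' id h4 _ _ hab⟩
  · rintro l x ⟨d, hd, hx⟩
    exact ⟨d, h3.mem_iff.2 hd, hx⟩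
  · rintro l x ⟨d, hd, hx⟩ -
    exact ⟨d, h3.mem_iff.2 hd, hx⟩
  · intro a ha b hb
    have ha' := hl.mem_iff.2 ha
    have hb' := hl.mem_iff.2 hb
    exact (h2.path_total ha' hb').imp (⟨ha', hb', ·⟩) (⟨hb', ha', ·⟩)

/-! ### Saturated limits -/

/-- Saturation of a possibly infinite structure, given by the reachability relation `R` between
labels, the formulae `M` and the signatures `X` of the components: it is closed under the analysis
of formulae and contains no instance of an axiom.  The labels of the structure are the `w` with
`R w w`. -/
structure Hintikka (L : QLogic) (R : Lab → Lab → Prop) (M : Lab → Pol QForm → Prop)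
    (X : Lab → Var → Prop) : Prop where
  trans : ∀ a b c, R a b → R b c → R a c
  refl_left : ∀ a b, R a b → R a a
  refl_right : ∀ a b, R a b → R b b
  root : ∀ a, R a a → R 0 a
  total : L.IsGodel → ∀ a b, R a a → R b b → R a b ∨ R b a
  mem_refl : ∀ w χ, M w χ → R w w
  not_id : ∀ w u p xs, M w (inp (.atom p xs)) → R w u → ¬ M u (out (.atom p xs))
  not_bot : ∀ w, ¬ M w (inp .bot)
  ds : ∀ w p xs, M w (inp (.atom p xs)) → ∀ i, X w (xs i)
  orIn : ∀ w φ ψ, M w (inp (.or φ ψ)) → M w (inp φ) ∨ M w (inp ψ)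
  andIn : ∀ w φ ψ, M w (inp (.and φ ψ)) → M w (inp φ) ∧ M w (inp ψ)
  impIn : ∀ w φ ψ u, M w (inp (.imp φ ψ)) → R w u → M u (out φ) ∨ M u (inp ψ)
  exIn : ∀ w x φ, M w (inp (.ex x φ)) → ∃ y, X w y ∧ M w (inp (φ.subst y x))
  allIn : ∀ w x φ u y, M w (inp (.all x φ)) → R w u →
    (¬ L.IsConstant → ∃ v, R v u ∧ X v y) → M u (inp (φ.subst y x))
  allIn_root : ∀ w x φ, M w (inp (.all x φ)) → ∃ z, X 0 z
  orOut : ∀ w φ ψ, M w (out (.or φ ψ)) → M w (out φ) ∧ M w (out ψ)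
  andOut : ∀ w φ ψ, M w (out (.and φ ψ)) → M w (out φ) ∨ M w (out ψ)
  impOut : ∀ w φ ψ, M w (out (.imp φ ψ)) → ∃ u, R w u ∧ M u (inp φ) ∧ M u (out ψ)
  exOut : ∀ w x φ y, M w (out (.ex x φ)) →
    (¬ L.IsConstant → ∃ v, R v w ∧ X v y) → M w (out (φ.subst y x))
  exOut_root : ∀ w x φ, M w (out (.ex x φ)) → ∃ z, X 0 z
  allOut : ∀ w x φ, M w (out (.all x φ)) →
    ∃ u y, R w u ∧ X u y ∧ M u (out (φ.subst y x))

/-- The tasks of the saturation: linearize, or analyse a formula of a component with the help of a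
further label and a variable. -/
abbrev Task : Type := Option (Lab × Pol QForm × Lab × Var)

/-- The formulae that carrying out a task may remove. -/
def Consumed : Task → Lab → Pol QForm → Prop
  | none, _, _ => False
  | some (w, χ, _, _), l, χ' => Only w χ l χ' ∧ Transient χ

/-- `S'` results from carrying out a task on `S`. -/
def Fulfilled (L : QLogic) (S S' : QSeq) : Task → Prop
  | none => L.IsGodel → ∀ a ∈ S.labels, ∀ b ∈ S.labels, S'.Reach a b ∨ S'.Reach b a
  | some (w, χ, u, y) => S.Mem w χ → Done L S S' w u y χ

variable {L : QLogic}

theorem Und.exists_fulfilled {S : QSeq} (hS : Und L S) (t : Task) :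
    ∃ S', Und L S' ∧ Ext (Consumed t) S S' ∧ Fulfilled L S S' t := by
  match t with
  | none =>
    by_cases hL : L.IsGodel
    · obtain ⟨S', h1, h2, h3⟩ := hS.linearize hL
      exact ⟨S', h1, h2.weaken (by simp), fun _ => h3⟩
    · exact ⟨S, hS, .refl _ _, fun h => (hL h).elim⟩
  | some (w, χ, u, y) =>
    by_cases h : S.Mem w χ
    · obtain ⟨S', h1, h2, h3⟩ := hS.step h u y
      exact ⟨S', h1, h2, fun _ => h3⟩
    · exact ⟨S, hS, .refl _ _, fun h' => (h h').elim⟩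

/-- An enumeration of the tasks in which every task recurs infinitely often. -/
theorem exists_task_enumeration : ∃ t : ℕ → Task, ∀ τ n, ∃ m, n ≤ m ∧ t m = τ := by
  obtain ⟨f, hf⟩ := exists_surjective_nat Task
  refine ⟨fun n => f n.unpair.1, fun τ n => ?_⟩
  obtain ⟨k, rfl⟩ := hf τ
  exact ⟨Nat.pair k n, Nat.right_le_pair _ _, by simp⟩

/-- The union of a sequence of underivable nested sequents in which every task gets carried out
again and again is a saturated structure.  Formulae may disappear along the sequence, but only when
they are analysed, and reachability and signatures only grow. -/
theorem Und.exists_hintikka {S : QSeq} (hS : Und L S) :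
    ∃ R M X, Hintikka L R M X ∧ (∀ a b, S.Reach a b → R a b) ∧
      (∀ w χ, S.Mem w χ → M w χ) ∧ ∀ w x, S.Sig w x → X w x := by
  classical
  obtain ⟨t, ht⟩ := exists_task_enumeration
  choose! next hnext using fun (S : QSeq) (τ : Task) (h : Und L S) => h.exists_fulfilled τ
  -- the sequence of sequents; its `n`-th step carries out the task `t n`
  let s : ℕ → QSeq := fun n => n.rec S fun n T => next T (t n)
  have hs : ∀ n, s (n + 1) = next (s n) (t n) := fun n => rfl
  have und : ∀ n, Und L (s n) := by
    intro n
    induction n with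
    | zero => exact hS
    | succ n ih => exact hs n ▸ (hnext _ _ ih).1
  have ext : ∀ n, Ext (Consumed (t n)) (s n) (s (n + 1)) := fun n => (hnext _ (t n) (und n)).2.1
  have ful : ∀ n, Fulfilled L (s n) (s (n + 1)) (t n) := fun n => (hnext _ (t n) (und n)).2.2
  have extAll : ∀ n m, n ≤ m → Ext (fun _ χ => Transient χ) (s n) (s m) := by
    intro n m h
    induction m, h using Nat.le_induction with
    | base => exact .refl _ _
    | succ m _ ih =>
      refine ih.trans ((ext m).weaken ?_)
      rcases t m with _ | ⟨w, χ, u, y⟩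
      · exact fun _ _ h => h.elim
      · rintro w' χ' ⟨⟨rfl, rfl⟩, h⟩
        exact h
  -- a formula that is still present when its task comes up is analysed then
  have attend : ∀ n w χ, (s n).Mem w χ → ∃ m, n ≤ m ∧ (s m).Mem w χ ∧
      ∃ u y, Done L (s m) (s (m + 1)) w u y χ := by
    intro n w χ h
    obtain ⟨m, hnm, hm⟩ := ht (some (w, χ, 0, 0)) n
    induction hk : m - n generalizing n with
    | zero =>
      obtain rfl : n = m := by omega
      have := ful n
      rw [hm] at this
      exact ⟨n, le_rfl, h, 0, 0, this h⟩
    | succ k ih =>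
      by_cases hc : Consumed (t n) w χ
      · have hf := ful n
        rcases htn : t n with _ | ⟨w', χ', u', y'⟩
        · rw [htn] at hc
          exact hc.elim
        · rw [htn] at hc hf
          obtain ⟨⟨rfl, rfl⟩, -⟩ := hc
          exact ⟨n, le_rfl, h, u', y', hf h⟩
      · obtain ⟨m', h1, h2⟩ := ih (n + 1) ((ext n).mem _ _ h hc) (by omega) (by omega)
        exact ⟨m', by omega, h2⟩
  -- a formula that is never removed is analysed with any parameters, arbitrarily late
  have attend' : ∀ n w χ u y, (s n).Mem w χ → ¬ Transient χ →
      ∃ m, n ≤ m ∧ Done L (s m) (s (m + 1)) w u y χ := by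
    intro n w χ u y h hχ
    obtain ⟨m, hnm, hm⟩ := ht (some (w, χ, u, y)) n
    have := ful m
    rw [hm] at this
    exact ⟨m, hnm, this ((extAll n m hnm).mem _ _ h hχ)⟩
  have avail : ∀ n y u v, (s n).Reach v u → (s n).Sig v y → (s n).Available y u :=
    fun n y u v h h' => available_iff.2 ⟨v, h, h'⟩
  refine ⟨fun a b => ∃ n, (s n).Reach a b, fun w χ => ∃ n, (s n).Mem w χ,
    fun w x => ∃ n, (s n).Sig w x, ?_, fun a b h => ⟨0, h⟩, fun w χ h => ⟨0, h⟩,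
    fun w x h => ⟨0, h⟩⟩
  -- instances admitted by the limit are admitted by all late sequents
  have inst : ∀ n u y, (¬ L.IsConstant → ∃ v, (∃ n, (s n).Reach v u) ∧ ∃ n, (s n).Sig v y) →
      ∃ m, n ≤ m ∧ ∀ k, m ≤ k → ¬ L.IsConstant → (s k).Available y u := by
    intro n u y h
    by_cases hc : L.IsConstant
    · exact ⟨n, le_rfl, fun _ _ h => (h hc).elim⟩
    · obtain ⟨v, ⟨i, hi⟩, j, hj⟩ := h hc
      refine ⟨max n (max i j), by simp, fun k hk _ => avail k y u v ?_ ?_⟩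
      · exact (extAll i k (by omega)).reach _ _ hi
      · exact (extAll j k (by omega)).sig _ _ hj
  constructor
  case trans =>
    rintro a b c ⟨n, hn⟩ ⟨m, hm⟩
    exact ⟨max n m, ((extAll n _ (by simp)).reach _ _ hn).trans
      ((extAll m _ (by simp)).reach _ _ hm)⟩
  case refl_left =>
    rintro a b ⟨n, hn⟩
    exact ⟨n, reach_refl hn.1⟩
  case refl_right =>
    rintro a b ⟨n, hn⟩
    exact ⟨n, reach_refl hn.2.1⟩
  case root =>
    rintro a ⟨n, hn⟩
    exact ⟨n, reach_zero hn.1⟩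
  case total =>
    rintro hL a b ⟨n, hn⟩ ⟨m, hm⟩
    obtain ⟨k, hk, hk'⟩ := ht none (max n m)
    have := ful k
    rw [hk'] at this
    exact (this hL a ((extAll n k (by omega)).label hn.1) b
      ((extAll m k (by omega)).label hm.1)).imp (⟨k + 1, ·⟩) (⟨k + 1, ·⟩)
  case mem_refl =>
    rintro w χ ⟨n, hn⟩
    exact ⟨n, reach_refl hn.label⟩
  case not_id =>
    rintro w u p xs ⟨i, hi⟩ ⟨j, hj⟩ ⟨k, hk⟩
    let m := max i (max j k)
    exact (und m).not_id ((extAll i m (by omega)).mem _ _ hi id)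
      ((extAll k m (by omega)).mem _ _ hk id) ((extAll j m (by omega)).reach _ _ hj)
  case not_bot =>
    rintro w ⟨n, hn⟩
    obtain ⟨m, -, h⟩ := attend' n w _ 0 0 hn id
    exact h
  case ds =>
    rintro w p xs ⟨n, hn⟩ i
    obtain ⟨m, -, h⟩ := attend' n w _ 0 0 hn id
    exact ⟨m + 1, h i⟩
  case orIn =>
    rintro w φ ψ ⟨n, hn⟩
    obtain ⟨m, -, -, _, _, h⟩ := attend n w _ hn
    exact h.imp (⟨m + 1, ·⟩) (⟨m + 1, ·⟩)
  case andIn =>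
    rintro w φ ψ ⟨n, hn⟩
    obtain ⟨m, -, -, _, _, h⟩ := attend n w _ hn
    exact ⟨⟨m + 1, h.1⟩, ⟨m + 1, h.2⟩⟩
  case impIn =>
    rintro w φ ψ u ⟨n, hn⟩ ⟨k, hk⟩
    obtain ⟨m, hm, h⟩ := attend' (max n k) w _ u 0 ((extAll n _ (by omega)).mem _ _ hn id) id
    exact (h ((extAll k m (by omega)).reach _ _ hk)).imp (⟨m + 1, ·⟩) (⟨m + 1, ·⟩)
  case exIn =>
    rintro w x φ ⟨n, hn⟩
    obtain ⟨m, -, -, _, _, y, h1, h2⟩ := attend n w _ hn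
    exact ⟨y, ⟨m + 1, h1⟩, m + 1, h2⟩
  case allIn =>
    rintro w x φ u y ⟨n, hn⟩ ⟨k, hk⟩ hy
    obtain ⟨i, hi, hi'⟩ := inst (max n k) u y hy
    obtain ⟨m, hm, -, h⟩ := attend' i w _ u y ((extAll n _ (by omega)).mem _ _ hn id) id
    exact ⟨m + 1, h ((extAll k m (by omega)).reach _ _ hk) (hi' m hm)⟩
  case allIn_root =>
    rintro w x φ ⟨n, hn⟩
    obtain ⟨m, -, ⟨z, hz⟩, -⟩ := attend' n w _ 0 0 hn id
    exact ⟨z, m + 1, hz⟩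
  case orOut =>
    rintro w φ ψ ⟨n, hn⟩
    obtain ⟨m, -, -, _, _, h⟩ := attend n w _ hn
    exact ⟨⟨m + 1, h.1⟩, ⟨m + 1, h.2⟩⟩
  case andOut =>
    rintro w φ ψ ⟨n, hn⟩
    obtain ⟨m, -, -, _, _, h⟩ := attend n w _ hn
    exact h.imp (⟨m + 1, ·⟩) (⟨m + 1, ·⟩)
  case impOut =>
    rintro w φ ψ ⟨n, hn⟩
    obtain ⟨m, -, -, _, _, u, h1, h2, h3⟩ := attend n w _ hn
    exact ⟨u, ⟨m + 1, h1⟩, ⟨m + 1, h2⟩, m + 1, h3⟩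
  case exOut =>
    rintro w x φ y ⟨n, hn⟩ hy
    obtain ⟨i, hi, hi'⟩ := inst n w y hy
    obtain ⟨m, hm, -, h⟩ := attend' i w _ 0 y ((extAll n _ hi).mem _ _ hn id) id
    exact ⟨m + 1, h (hi' m hm)⟩
  case exOut_root =>
    rintro w x φ ⟨n, hn⟩
    obtain ⟨m, -, ⟨z, hz⟩, -⟩ := attend' n w _ 0 0 hn id
    exact ⟨z, m + 1, hz⟩
  case allOut =>
    rintro w x φ ⟨n, hn⟩
    obtain ⟨m, -, -, _, _, u, y, h1, h2, h3⟩ := attend n w _ hn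
    exact ⟨u, y, ⟨m + 1, h1⟩, ⟨m + 1, h2⟩, m + 1, h3⟩

/-! ### Countermodels -/

namespace Hintikka

variable {R : Lab → Lab → Prop} {M : Lab → Pol QForm → Prop} {X : Lab → Var → Prop}

/-- Some formula has to be instantiated by all elements of the domains. -/
def Instantiates (M : Lab → Pol QForm → Prop) : Prop :=
  ∃ w x φ, M w (inp (.all x φ)) ∨ M w (out (.ex x φ))

/-- The domain of the label `w`: the available variables, but all variables if the domains are to
be constant, if no formula has to be instantiated (there may be no available variable then), or if
`w` is not a label of the structure. -/
def dom (L : QLogic) (R : Lab → Lab → Prop) (M : Lab → Pol QForm → Prop) (X : Lab → Var → Prop)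
    (w : Lab) : Set Var :=
  {y | ¬ L.IsConstant → Instantiates M → R 0 w → ∃ v, R v w ∧ X v y}

/-- The reflexive closure of `R` on the labels, with an additional isolated world `none`. -/
def WorldLE (R : Lab → Lab → Prop) (a b : Option Lab) : Prop :=
  a = b ∨ ∃ w u, a = some w ∧ b = some u ∧ R w u

/-- The model of a saturated structure.  The worlds are the labels, with the reachability relation
made reflexive, and an additional isolated world `none`, which has all variables in its domain.
The latter makes every variable an element of some domain. -/
def model (h : Hintikka L R M X) : QModel where
  W := Option Lab
  nonempty := ⟨none⟩
  preorder :=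
    { le := WorldLE R
      lt := fun a b => WorldLE R a b ∧ ¬ WorldLE R b a
      lt_iff_le_not_ge := fun _ _ => Iff.rfl
      le_refl := fun a => .inl rfl
      le_trans := by
        rintro a b c (rfl | ⟨w, u, rfl, rfl, hwu⟩) (rfl | ⟨w', v, h1, rfl, huv⟩)
        · exact .inl rfl
        · exact .inr ⟨w', v, h1, rfl, huv⟩
        · exact .inr ⟨w, u, rfl, rfl, hwu⟩
        · cases h1
          exact .inr ⟨w, v, rfl, rfl, h.trans _ _ _ hwu huv⟩ }
  U := Var
  D := fun a => a.elim Set.univ (dom L R M X)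
  D_nonempty := by
    rintro (_ | w)
    · exact ⟨0, trivial⟩
    · by_cases hi : Instantiates M
      · have : ∃ z, X 0 z := by
          obtain ⟨w, x, φ, h' | h'⟩ := hi
          · exact h.allIn_root _ _ _ h'
          · exact h.exOut_root _ _ _ h'
        obtain ⟨z, hz⟩ := this
        exact ⟨z, fun _ _ h0 => ⟨0, h0, hz⟩⟩
      · exact ⟨0, fun _ hi' => (hi hi').elim⟩
  D_mono := by
    rintro a b (rfl | ⟨w, u, rfl, rfl, hwu⟩)
    · exact subset_rfl
    · intro y hy hc hi _
      obtain ⟨v, hv, hvy⟩ := hy hc hi (h.root _ (h.refl_left _ _ hwu))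
      exact ⟨v, h.trans _ _ _ hv hwu, hvy⟩
  V := fun p a => {xs | ∃ u, a = some u ∧ ∃ v, R v u ∧ M v (inp (.atom p xs))}
  V_sub := by
    rintro p a xs ⟨u, rfl, v, hvu, hv⟩ i
    exact fun _ _ _ => ⟨v, hvu, h.ds _ _ _ hv i⟩
  V_mono := by
    rintro p a b (rfl | ⟨w, u, rfl, rfl, hwu⟩)
    · exact subset_rfl
    · rintro xs ⟨w', hw', v, hv, hvm⟩
      cases hw'
      exact ⟨u, rfl, v, h.trans _ _ _ hv hwu, hvm⟩

theorem model_isModel (h : Hintikka L R M X) : L.IsModel h.model := by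
  constructor
  · intro hc
    have : ∀ a, h.model.D a = Set.univ := by
      rintro (_ | w)
      · rfl
      · exact Set.eq_univ_of_forall fun y hc' => (hc' hc).elim
    intro a b
    rw [this, this]
  · rintro hL a b c (rfl | ⟨w, u, rfl, rfl, hwu⟩) (rfl | ⟨w', v, h1, rfl, hwv⟩)
    · exact .inl (.inl rfl)
    · exact .inl (.inr ⟨w', v, h1, rfl, hwv⟩)
    · exact .inr (.inr ⟨w, u, rfl, rfl, hwu⟩)
    · cases h1
      exact (h.total hL u v (h.refl_right _ _ hwu) (h.refl_right _ _ hwv)).imp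
        (.inr ⟨u, v, rfl, rfl, ·⟩) (.inr ⟨v, u, rfl, rfl, ·⟩)

theorem reach_of_le {w : Lab} (hw : R w w) {a : Option Lab}
    (ha : WorldLE R (some w) a) : ∃ u, a = some u ∧ R w u := by
  rcases ha with rfl | ⟨w', u, h1, rfl, hwu⟩
  · exact ⟨w, rfl, hw⟩
  · cases h1
    exact ⟨u, rfl, hwu⟩

/-- The exceptional elements of the domains are not needed as instances. -/
theorem available_of_mem_dom (h : Hintikka L R M X) (hi : Instantiates M) {w : Lab} (hw : R w w)
    {y : Var} (hy : y ∈ dom L R M X w) (hc : ¬ L.IsConstant) : ∃ v, R v w ∧ X v y :=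
  hy hc hi (h.root w hw)

/-- Input formulae are forced and output formulae are not, under the assignment of each variable
to itself.  The induction is on the size, since instances of a quantified formula are not
subformulae. -/
theorem truth (h : Hintikka L R M X) (φ : QForm) (w : Lab) :
    (M w (inp φ) → h.model.Forces (some w) (fun x : Var => x) φ) ∧
      (M w (out φ) → ¬ h.model.Forces (some w) (fun x : Var => x) φ) := by
  induction hn : φ.size using Nat.strong_induction_on generalizing φ w with
  | _ n ih =>
  subst hn
  have subst_iff : ∀ (x y : Var) (φ : QForm) (a : Option Lab),
      h.model.Forces a (Function.update (fun x : Var => x) x y) φ ↔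
        h.model.Forces a (fun x : Var => x) (φ.subst y x) :=
    fun x y φ a => (h.model.forces_subst (μ := fun x : Var => x)).symm
  match φ with
  | .atom p xs =>
    refine ⟨fun hm => ⟨w, rfl, w, h.mem_refl _ _ hm, hm⟩, ?_⟩
    rintro hm ⟨u, hu, v, hv, hvm⟩
    cases hu
    exact h.not_id _ _ _ _ hvm hv hm
  | .bot => exact ⟨fun hm => (h.not_bot _ hm).elim, fun _ hf => hf⟩
  | .or φ ψ =>
    have ihφ := ih φ.size (by simp [QForm.size]) φ w rfl
    have ihψ := ih ψ.size (by simp [QForm.size]) ψ w rfl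
    refine ⟨fun hm => (h.orIn _ _ _ hm).imp ihφ.1 ihψ.1, fun hm => ?_⟩
    obtain ⟨h1, h2⟩ := h.orOut _ _ _ hm
    exact fun hf => hf.elim (ihφ.2 h1) (ihψ.2 h2)
  | .and φ ψ =>
    have ihφ := ih φ.size (by simp [QForm.size]) φ w rfl
    have ihψ := ih ψ.size (by simp [QForm.size]) ψ w rfl
    refine ⟨fun hm => (h.andIn _ _ _ hm).imp ihφ.1 ihψ.1, fun hm hf => ?_⟩
    exact (h.andOut _ _ _ hm).elim (ihφ.2 · hf.1) (ihψ.2 · hf.2)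
  | .imp φ ψ =>
    have ihφ := fun w => ih φ.size (by simp [QForm.size]) φ w rfl
    have ihψ := fun w => ih ψ.size (by simp [QForm.size]) ψ w rfl
    constructor
    · intro hm a ha hf
      obtain ⟨u, rfl, hwu⟩ := reach_of_le (h.mem_refl _ _ hm) ha
      exact (h.impIn _ _ _ u hm hwu).elim (fun h' => ((ihφ u).2 h' hf).elim) (ihψ u).1
    · intro hm hf
      obtain ⟨u, hwu, h1, h2⟩ := h.impOut _ _ _ hm
      exact (ihψ u).2 h2 (hf (some u) (.inr ⟨w, u, rfl, rfl, hwu⟩) ((ihφ u).1 h1))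
  | .ex x φ =>
    have ihφ := fun y => ih (φ.subst y x).size (by simp [QForm.size]) (φ.subst y x) w rfl
    constructor
    · intro hm
      obtain ⟨y, hy, h1⟩ := h.exIn _ _ _ hm
      exact ⟨y, fun _ _ _ => ⟨w, h.mem_refl _ _ hm, hy⟩, (subst_iff x y φ _).2 ((ihφ y).1 h1)⟩
    · rintro hm ⟨y, hy, hf⟩
      exact (ihφ y).2 (h.exOut _ _ _ _ hm
        (h.available_of_mem_dom ⟨w, x, φ, .inr hm⟩ (h.mem_refl _ _ hm) hy))
        ((subst_iff x y φ _).1 hf)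
  | .all x φ =>
    have ihφ := fun y w => ih (φ.subst y x).size (by simp [QForm.size]) (φ.subst y x) w rfl
    constructor
    · intro hm a ha y hy
      obtain ⟨u, rfl, hwu⟩ := reach_of_le (h.mem_refl _ _ hm) ha
      exact (subst_iff x y φ _).2 ((ihφ y u).1 (h.allIn _ _ _ u y hm hwu
        (h.available_of_mem_dom ⟨w, x, φ, .inl hm⟩ (h.refl_right _ _ hwu) hy)))
    · intro hm hf
      obtain ⟨u, y, hwu, hy, h1⟩ := h.allOut _ _ _ hm
      exact (ihφ y u).2 h1 ((subst_iff x y φ _).1 (hf (some u) (.inr ⟨w, u, rfl, rfl, hwu⟩) y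
        fun _ _ _ => ⟨u, h.refl_right _ _ hwu, hy⟩))

end Hintikka

/-- The interpretation `ι` respects the edges of `S`, and no component of `S` is satisfied. -/
structure Refutes (M : QModel) (ι : Lab → M.W) (μ : Var → M.U) (r : Lab) (S : QSeq) : Prop where
  edge : ∀ a b, (a, b) ∈ S.edgesFrom r → ι a ≤ ι b
  comp : ∀ l c, (l, c) ∈ S.nodesFrom r → ¬ CompSat M μ (ι l) c

/-- An underivable nested sequent has a countermodel. -/
theorem Und.exists_refutes {S : QSeq} (hS : Und L S) :
    ∃ (M : QModel) (ι : Lab → M.W) (μ : Var → M.U), L.IsModel M ∧ M.IsAssignment μ ∧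
      Refutes M ι μ 0 S := by
  obtain ⟨R, M, X, h, hR, hM, hX⟩ := hS.exists_hintikka
  refine ⟨h.model, fun l => some l, fun x => x, h.model_isModel,
    fun x => Set.mem_iUnion.2 ⟨none, trivial⟩, ⟨fun a b hab => ?_, fun l c hc hsat => ?_⟩⟩
  · exact .inr ⟨a, b, rfl, rfl, hR _ _ (reach_of_edge hab)⟩
  · have hl : R l l := hR _ _ (reach_refl (mem_labelsFrom.2 ⟨c, hc⟩))
    obtain ⟨ψ, hψ, hf⟩ := hsat (fun x hx => fun _ _ _ => ⟨l, hl, hX _ _ ⟨c, hc, hx⟩⟩)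
      (fun φ hφ => (h.truth φ l).1 (hM _ _ ⟨c, hc, hφ⟩))
    exact (h.truth ψ l).2 (hM _ _ ⟨c, hc, hψ⟩) hf

theorem Refutes.left {M : QModel} {ι : Lab → M.W} {μ : Var → M.U} {r w : Lab} {S T : QSeq}
    (h : Refutes M ι μ r (nest S w T)) : Refutes M ι μ r S :=
  ⟨fun a b hab => h.edge a b (by simp [edgesFrom, hab]),
    fun l c hc => h.comp l c (by simp [nodesFrom, hc])⟩

theorem Refutes.right {M : QModel} {ι : Lab → M.W} {μ : Var → M.U} {r w : Lab} {S T : QSeq}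
    (h : Refutes M ι μ r (nest S w T)) : Refutes M ι μ w T :=
  ⟨fun a b hab => h.edge a b (by simp [edgesFrom, hab]),
    fun l c hc => h.comp l c (by simp [nodesFrom, hc])⟩

theorem Refutes.root {M : QModel} {ι : Lab → M.W} {μ : Var → M.U} {r : Lab} {S : QSeq}
    (h : Refutes M ι μ r S) : ¬ CompSat M μ (ι r) S.root := by
  induction S with
  | flat c => exact h.comp r c (by simp [nodesFrom])
  | nest S w T ihS _ => exact ihS h.left

theorem Refutes.le_of_mem_topLabels {M : QModel} {ι : Lab → M.W} {μ : Var → M.U} {r : Lab}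
    {S : QSeq} (h : Refutes M ι μ r S) : ∀ t ∈ S.topLabels, ι r ≤ ι t := by
  induction S with
  | flat c => simp [topLabels]
  | nest S w T ihS _ =>
    intro t ht
    rcases List.mem_append.1 ht with ht | ht
    · exact ihS h.left t ht
    · obtain rfl : t = w := by simpa using ht
      exact h.edge _ _ (by simp [edgesFrom])

theorem Refutes.not_nestSat {M : QModel} {ι : Lab → M.W} {μ : Var → M.U} {r : Lab} {S : QSeq}
    (h : Refutes M ι μ r S) : ¬ NestSat M ι μ S := by
  induction S generalizing r with
  | flat c => exact id
  | nest S w T ihS ihT =>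
    rintro (hS | hT)
    · exact ihS h.left hS
    · exact (hT h.right.le_of_mem_topLabels).elim h.right.root (ihT h.right)

theorem Refutes.not_sat {M : QModel} {ι : Lab → M.W} {μ : Var → M.U} {r : Lab} {S : QSeq}
    (h : Refutes M ι μ r S) : ¬ S.Sat M ι μ r :=
  fun hsat => (hsat h.le_of_mem_topLabels).elim h.root h.not_nestSat

/-- Completeness of the calculi for the first-order logics. -/
theorem derivable_of_valid {S : QSeq} (hS : S.UniqueLabels) (hv : S.Valid L) :
    QDerivable L S := by
  by_contra hnd
  obtain ⟨M, ι, μ, hM, hμ, href⟩ := Und.exists_refutes ⟨hS, hnd⟩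
  exact href.not_sat (hv M hM ι μ hμ)

end QSeq

/-! ### Changing the component data -/

namespace Nested

section Map

variable {C E : Type}

/-- Apply `f` to all components. -/
def map (f : C → E) : Nested C → Nested E
  | flat c => flat (f c)
  | nest S w T => nest (S.map f) w (T.map f)

theorem nodesFrom_map (f : C → E) (r : Lab) (S : Nested C) :
    (S.map f).nodesFrom r = (S.nodesFrom r).map fun n => (n.1, f n.2) := by
  induction S generalizing r <;> simp_all [map, nodesFrom]

theorem edgesFrom_map (f : C → E) (r : Lab) (S : Nested C) :
    (S.map f).edgesFrom r = S.edgesFrom r := by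
  induction S generalizing r <;> simp_all [map, edgesFrom]

@[simp] theorem labels_map (f : C → E) (S : Nested C) : (S.map f).labels = S.labels := by
  simp [labels, nodes, nodesFrom_map, Function.comp_def]

@[simp] theorem reach_map (f : C → E) (S : Nested C) (a b : Lab) :
    (S.map f).Reach a b ↔ S.Reach a b := by
  simp [Reach, edges, edgesFrom_map]

theorem map_map_of_leftInverse {f : C → E} {g : E → C} (h : Function.LeftInverse g f)
    (S : Nested C) : (S.map f).map g = S := by
  induction S <;> simp_all [map, h _]

theorem Perm.map {S T : Nested C} (h : S.Perm T) (f : C → E) : (S.map f).Perm (T.map f) := by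
  induction h with
  | refl S => exact .refl _
  | symm _ ih => exact ih.symm
  | trans _ _ ih₁ ih₂ => exact ih₁.trans ih₂
  | swap S v T u U => exact .swap _ _ _ _ _
  | congr w _ _ ih₁ ih₂ => exact .congr w ih₁ ih₂

variable [AddCommMonoid C] [AddCommMonoid E]

theorem map_fill (f : C →+ E) (S : Nested C) (w : Lab) (D : Nested C) :
    (S.fill w D).map f = (S.map f).fill w (D.map f) := by
  have hadd : ∀ (S : Nested C) c, (S.addRoot c).map f = (S.map f).addRoot (f c) := by
    intro S c
    induction S <;> simp_all [map, addRoot]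
  have hmerge : ∀ S : Nested C, (S.merge D).map f = (S.map f).merge (D.map f) := by
    intro S
    induction D <;> simp_all [map, merge]
  have hbelow : (fillBelow w D S).map f = fillBelow w (D.map f) (S.map f) := by
    induction S with
    | flat c => rfl
    | nest S v T ihS ihT =>
      simp only [map, fillBelow, ihS]
      split_ifs <;> simp [hmerge, ihT]
  unfold fill
  split_ifs <;> simp [hmerge, hbelow]

theorem map_bracket (f : C →+ E) (w : Lab) (T : Nested C) :
    (bracket w T).map f = bracket w (T.map f) := by
  simp [bracket, map]

end Map

section All

variable {C : Type}

/-- All components have the property `P`. -/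
def All (P : C → Prop) : Nested C → Prop
  | flat c => P c
  | nest S _ T => S.All P ∧ T.All P

theorem all_map {E : Type} {f : C → E} {P : E → Prop} (h : ∀ c, P (f c)) (S : Nested C) :
    (S.map f).All P := by
  induction S <;> simp_all [All, map]

theorem Perm.all_iff {P : C → Prop} {S T : Nested C} (h : S.Perm T) : S.All P ↔ T.All P := by
  induction h with
  | refl S => rfl
  | symm _ ih => exact ih.symm
  | trans _ _ ih₁ ih₂ => exact ih₁.trans ih₂
  | swap S v T u U => simp only [All]; tauto
  | congr w _ _ ih₁ ih₂ => simp only [All, ih₁, ih₂]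

variable [AddCommMonoid C]

theorem labelsFrom_addRoot (r : Lab) (S : Nested C) (c : C) :
    (S.addRoot c).labelsFrom r = S.labelsFrom r := by
  induction S generalizing r <;> simp_all [addRoot]

@[simp] theorem labels_fill_flat (S : Nested C) (w : Lab) (c : C) :
    (S.fill w (flat c)).labels = S.labels := by
  have hbelow : ∀ r, (fillBelow w (flat c) S).labelsFrom r = S.labelsFrom r := by
    induction S with
    | flat c => simp [fillBelow]
    | nest S v T ihS ihT =>
      intro r
      simp only [fillBelow, labelsFrom_nest, ihS]
      split_ifs <;> simp [merge, labelsFrom_addRoot, ihT]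
  change labelsFrom 0 _ = labelsFrom 0 _
  unfold fill
  split_ifs
  · exact labelsFrom_addRoot 0 S c
  · exact hbelow 0

theorem all_fill {P : C → Prop} (hP : ∀ a b, P (a + b) ↔ P a ∧ P b) {S D : Nested C} {w : Lab}
    (hw : w ∈ S.labels) : (S.fill w D).All P ↔ S.All P ∧ D.All P := by
  have hadd : ∀ (S : Nested C) c, (S.addRoot c).All P ↔ S.All P ∧ P c := by
    intro S c
    induction S with
    | flat d => exact hP d c
    | nest S w T ihS _ => simp only [addRoot, All, ihS]; tauto
  have hmerge : ∀ S : Nested C, (S.merge D).All P ↔ S.All P ∧ D.All P := by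
    intro S
    induction D with
    | flat c => exact hadd S c
    | nest D w T ihD _ => simp only [merge, All, ihD]; tauto
  have hbelow : S.All P → D.All P → (fillBelow w D S).All P := by
    clear hw
    intro hS hD
    induction S with
    | flat c => exact hS
    | nest S v T ihS ihT =>
      refine ⟨ihS hS.1, ?_⟩
      split_ifs
      · exact (hmerge T).2 ⟨hS.2, hD⟩
      · exact ihT hS.2
  have hcontext : (fillBelow w D S).All P → S.All P := by
    clear hw hbelow
    intro h
    induction S with
    | flat c => exact h
    | nest S v T ihS ihT =>
      refine ⟨ihS h.1, ?_⟩
      have hT := h.2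
      split_ifs at hT
      · exact ((hmerge T).1 hT).1
      · exact ihT hT
  have hdata : ∀ r, w ∈ S.labelsFrom r → w ≠ r → (fillBelow w D S).All P → D.All P := by
    clear hw hbelow hcontext
    induction S with
    | flat c => simp
    | nest S v T ihS ihT =>
      intro r hw hr h
      rw [labelsFrom_nest, List.mem_append] at hw
      rcases hw with hw | hw
      · exact ihS r hw hr h.1
      · have hT := h.2
        split_ifs at hT with hv
        · exact ((hmerge T).1 hT).2
        · exact ihT v hw (Ne.symm hv) hT
  unfold fill
  split_ifs with h0
  · exact hmerge S
  · exact ⟨fun h => ⟨hcontext h, hdata 0 hw h0 h⟩, fun h => hbelow h.1 h.2⟩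

end All

end Nested

/-! ### Propositional formulae as first-order formulae -/

namespace PForm

/-- Propositional variables as nullary predicates. -/
def toQ : PForm → QForm
  | var p => .atom ⟨0, p⟩ Fin.elim0
  | bot => .bot
  | or φ ψ => .or φ.toQ ψ.toQ
  | and φ ψ => .and φ.toQ ψ.toQ
  | imp φ ψ => .imp φ.toQ ψ.toQ

end PForm

namespace QForm

/-- The propositional formula obtained by forgetting the arguments of predicates; it is only used
for formulae without quantifiers. -/
def toP : QForm → PForm
  | atom p _ => .var p.index
  | bot => .bot
  | or φ ψ => .or φ.toP ψ.toP
  | and φ ψ => .and φ.toP ψ.toP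
  | imp φ ψ => .imp φ.toP ψ.toP
  | ex _ _ => .bot
  | all _ _ => .bot

/-- The formula contains no quantifier. -/
def QFree : QForm → Prop
  | atom _ _ => True
  | bot => True
  | or φ ψ => φ.QFree ∧ ψ.QFree
  | and φ ψ => φ.QFree ∧ ψ.QFree
  | imp φ ψ => φ.QFree ∧ ψ.QFree
  | ex _ _ => False
  | all _ _ => False

end QForm

theorem PForm.toP_toQ (φ : PForm) : φ.toQ.toP = φ := by
  induction φ <;> simp_all [PForm.toQ, QForm.toP]

theorem PForm.qFree_toQ (φ : PForm) : φ.toQ.QFree := by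
  induction φ <;> simp_all [PForm.toQ, QForm.QFree]

/-- Apply `f` to a polarized formula. -/
def Pol.map {F G : Type} (f : F → G) : Pol F → Pol G
  | inp φ => inp (f φ)
  | out φ => out (f φ)

/-- A propositional component as a first-order component with empty signature. -/
def compToQ (Γ : Multiset (Pol PForm)) : Multiset Var × Multiset (Pol QForm) :=
  (0, Γ.map (Pol.map PForm.toQ))

/-- The propositional component of a first-order component. -/
def compToP : Multiset Var × Multiset (Pol QForm) →+ Multiset (Pol PForm) :=
  (Multiset.mapAddMonoidHom (Pol.map QForm.toP)).comp (AddMonoidHom.snd _ _)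

theorem compToP_apply (X : Multiset Var) (Γ : Multiset (Pol QForm)) :
    compToP (X, Γ) = Γ.map (Pol.map QForm.toP) := rfl

theorem compToP_compToQ (Γ : Multiset (Pol PForm)) : compToP (compToQ Γ) = Γ := by
  have : Pol.map QForm.toP ∘ Pol.map PForm.toQ = id := by
    funext χ
    cases χ <;> simp [Pol.map, PForm.toP_toQ]
  rw [compToQ, compToP_apply, Multiset.map_map, this, Multiset.map_id]

/-- A component without quantifiers. -/
def CompQFree (c : Multiset Var × Multiset (Pol QForm)) : Prop := ∀ χ ∈ c.2, χ.form.QFree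

theorem compQFree_add (a b : Multiset Var × Multiset (Pol QForm)) :
    CompQFree (a + b) ↔ CompQFree a ∧ CompQFree b := by
  simp [CompQFree, or_imp, forall_and]

theorem compQFree_compToQ (Γ : Multiset (Pol PForm)) : CompQFree (compToQ Γ) := by
  intro χ hχ
  obtain ⟨χ', -, rfl⟩ := Multiset.mem_map.1 hχ
  cases χ' <;> exact PForm.qFree_toQ _

theorem qFree_fill {S D : QSeq} {w : Lab} (hw : w ∈ S.labels) :
    (S.fill w D).All CompQFree ↔ S.All CompQFree ∧ D.All CompQFree :=
  all_fill compQFree_add hw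

/-- A derivation of a sequent without quantifiers is, up to signatures and arguments of
predicates, a derivation in the propositional calculus. -/
theorem QDerivable.toP {L : QLogic} {K : PLogic} (hK : L.IsGodel → K = .GD) {S : QSeq}
    (h : QDerivable L S) (hS : S.All CompQFree) : PDerivable K (S.map compToP) := by
  have hmap : ∀ X Γ, Nested.map compToP (QSeq.of X Γ) = PSeq.of (Γ.map (Pol.map QForm.toP)) :=
    fun _ _ => rfl
  have hof : ∀ X Γ, Nested.All CompQFree (QSeq.of X Γ) ↔ ∀ χ ∈ Γ, χ.form.QFree :=
    fun _ _ => Iff.rfl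
  have hbr : ∀ u T, Nested.All CompQFree (bracket u T) ↔ T.All CompQFree :=
    fun u T => by simp [bracket, All, CompQFree]
  induction h with
  | exch hST _ ih => exact .exch (hST.map _) (ih (hST.all_iff.2 hS))
  | id S w u p xs hwu =>
    simp only [map_fill, hmap, Multiset.map_singleton, Pol.map, QForm.toP]
    exact .id _ w u _ ((reach_map _ _ _ _).2 hwu)
  | botIn S w hw =>
    simp only [map_fill, hmap, Multiset.map_singleton, Pol.map, QForm.toP]
    exact .botIn _ w (by simpa using hw)
  | ds S w p xs hw _ ih =>
    simp only [map_fill, hmap, Multiset.map_singleton, Pol.map, QForm.toP] at ih ⊢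
    refine ih ?_
    rw [qFree_fill hw] at hS ⊢
    exact hS
  | orIn S w φ ψ hw _ _ ih₁ ih₂ =>
    rw [qFree_fill hw, hof] at hS ih₁ ih₂
    simp only [map_fill, hmap, Multiset.map_singleton, Pol.map, QForm.toP] at ih₁ ih₂ ⊢
    simp [Pol.form, QForm.QFree] at hS ih₁ ih₂
    exact .orIn _ w _ _ (by simpa using hw) (ih₁ hS.1 hS.2.1) (ih₂ hS.1 hS.2.2)
  | orOut S w φ ψ hw _ ih =>
    rw [qFree_fill hw, hof] at hS ih
    simp [map_fill, hmap, Pol.map, QForm.toP, Pol.form, QForm.QFree] at hS ih ⊢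
    exact .orOut _ w _ _ (by simpa using hw) (ih hS.1 hS.2.1 hS.2.2)
  | andIn S w φ ψ hw _ ih =>
    rw [qFree_fill hw, hof] at hS ih
    simp [map_fill, hmap, Pol.map, QForm.toP, Pol.form, QForm.QFree] at hS ih ⊢
    exact .andIn _ w _ _ (by simpa using hw) (ih hS.1 hS.2.1 hS.2.2)
  | andOut S w φ ψ hw _ _ ih₁ ih₂ =>
    rw [qFree_fill hw, hof] at hS ih₁ ih₂
    simp [map_fill, hmap, Pol.map, QForm.toP, Pol.form, QForm.QFree] at hS ih₁ ih₂ ⊢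
    exact .andOut _ w _ _ (by simpa using hw) (ih₁ hS.1 hS.2.1) (ih₂ hS.1 hS.2.2)
  | impOut S w u φ ψ hw hu _ ih =>
    rw [qFree_fill hw] at hS ih
    rw [hof] at hS
    rw [hbr, hof] at ih
    simp [map_fill, map_bracket, hmap, Pol.map, QForm.toP, Pol.form, QForm.QFree] at hS ih ⊢
    exact .impOut _ w u _ _ (by simpa using hw) (by simpa using hu) (ih hS.1 hS.2.1 hS.2.2)
  | impIn S w u φ ψ hwu _ _ ih₁ ih₂ =>
    have hu : u ∈ (S.fill w (QSeq.of 0 {inp (.imp φ ψ)})).labels := by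
      simpa [QSeq.of] using hwu.2.1
    rw [qFree_fill hu, hof] at ih₁ ih₂
    have hS' := hS
    rw [qFree_fill hwu.1, hof] at hS'
    simp [map_fill, hmap, Pol.map, QForm.toP, Pol.form, QForm.QFree] at hS' ih₁ ih₂ ⊢
    exact .impIn _ w u _ _ (by simpa using hwu) (ih₁ hS hS'.2.1) (ih₂ hS hS'.2.2)
  | exOut1 S w x y φ hw _ _ _ | exIn S w x y φ hw _ _ _ | allOut S w _ x y φ hw _ _ _ _ =>
    rw [qFree_fill hw, hof] at hS
    simp [Pol.form, QForm.QFree] at hS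
  | exOut2 S _ u x y φ _ hu _ _ _ _ =>
    rw [qFree_fill hu, hof] at hS
    simp [Pol.form, QForm.QFree] at hS
  | allIn1 S w u x y φ hwu _ _ _ =>
    rw [qFree_fill hwu.1, hof] at hS
    simp [Pol.form, QForm.QFree] at hS
  | allIn2 S _ u v x y φ _ huv _ _ _ _ =>
    rw [qFree_fill huv.1, hof] at hS
    simp [Pol.form, QForm.QFree] at hS
  | lin S w v u Γ Δ hL hw _ _ ih₁ ih₂ =>
    rw [qFree_fill hw] at hS ih₁ ih₂
    simp only [map_fill, map_bracket, Nested.map] at ih₁ ih₂ ⊢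
    rw [hbr] at ih₁ ih₂
    simp only [All, hbr] at hS ih₁ ih₂
    exact .lin _ w v u _ _ (hK hL) (by simpa using hw) (ih₁ hS) (ih₂ ⟨hS.1, hS.2.2, hS.2.1⟩)

/-! ### The formula interpretation -/

namespace PModel

variable (M : PModel)

theorem forces_mono {w v : M.W} (h : w ≤ v) {φ : PForm} (hφ : M.Forces w φ) : M.Forces v φ := by
  induction φ generalizing w v with
  | var p => exact M.mono p w v h hφ
  | bot => exact hφ
  | or φ ψ ih₁ ih₂ => exact hφ.imp (ih₁ h) (ih₂ h)
  | and φ ψ ih₁ ih₂ => exact hφ.imp (ih₁ h) (ih₂ h)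
  | imp φ ψ ih₁ ih₂ => exact fun u hu => hφ u (h.trans hu)

theorem forces_bigAnd {w : M.W} {l : List PForm} :
    M.Forces w (.bigAnd l) ↔ ∀ φ ∈ l, M.Forces w φ := by
  induction l with
  | nil => simp [PForm.bigAnd, PForm.top, Forces]
  | cons φ l ih => cases l <;> simp_all [PForm.bigAnd, Forces]

theorem forces_bigOr {w : M.W} {l : List PForm} :
    M.Forces w (.bigOr l) ↔ ∃ φ ∈ l, M.Forces w φ := by
  induction l with
  | nil => simp [PForm.bigOr, Forces]
  | cons φ l ih => cases l <;> simp_all [PForm.bigOr, Forces]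

theorem not_forces_compInterp {w : M.W} {Γ : Multiset (Pol PForm)} {l : List PForm}
    (hin : ∀ φ, inp φ ∈ Γ → M.Forces w φ) (hout : ∀ φ, out φ ∈ Γ → ¬ M.Forces w φ)
    (hl : ∀ φ ∈ l, ¬ M.Forces w φ) : ¬ M.Forces w (compInterp Γ l) := by
  have h1 : M.Forces w (.bigAnd (Γ.filterMap Pol.input?).toList) := by
    rw [forces_bigAnd]
    intro φ hφ
    rw [Multiset.mem_toList, Multiset.mem_filterMap] at hφ
    obtain ⟨χ | χ, hχ, h⟩ := hφ
    · cases h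
      exact hin _ hχ
    · cases h
  have h2 : ¬ M.Forces w (.bigOr (Γ.filterMap Pol.output?).toList) := by
    rw [forces_bigOr]
    rintro ⟨φ, hφ, hf⟩
    rw [Multiset.mem_toList, Multiset.mem_filterMap] at hφ
    obtain ⟨χ | χ, hχ, h⟩ := hφ
    · cases h
    · cases h
      exact hout _ hχ hf
  cases l with
  | nil => exact fun h => h2 (h w le_rfl h1)
  | cons φ l =>
    intro h
    rcases h w le_rfl h1 with h | h
    · exact h2 h
    · obtain ⟨ψ, hψ, hf⟩ := (forces_bigOr M).1 h
      exact hl ψ hψ hf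

end PModel

/-- The propositional model given by the nullary predicates. -/
def QModel.toP (M : QModel) : PModel where
  toFrame := M.toFrame
  V := fun p w => Fin.elim0 ∈ M.V ⟨0, p⟩ w
  mono := fun p w v h hw => M.V_mono ⟨0, p⟩ w v h hw

theorem QModel.forces_toQ (M : QModel) {w : M.W} {μ : Var → M.U} {φ : PForm} :
    M.Forces w μ φ.toQ ↔ M.toP.Forces w φ := by
  induction φ generalizing w with
  | var p =>
    have : (fun i : Fin 0 => μ (Fin.elim0 i)) = Fin.elim0 := funext fun i => i.elim0
    change (fun i : Fin 0 => μ (Fin.elim0 i)) ∈ M.V ⟨0, p⟩ w ↔ _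
    rw [this]
    rfl
  | bot => rfl
  | or φ ψ ih₁ ih₂ => exact or_congr ih₁ ih₂
  | and φ ψ ih₁ ih₂ => exact and_congr ih₁ ih₂
  | imp φ ψ ih₁ ih₂ => exact forall_congr' fun u => imp_congr_right fun _ => imp_congr ih₁ ih₂

/-- A countermodel of a translated nested sequent does not force the formula interpretation at the
root, provided that it does not force the interpretations of the nestings. -/
theorem not_forces_compInterp_root {M : QModel} {ι : Lab → M.W} {μ : Var → M.U} {r : Lab}
    {S : PSeq} (h : QSeq.Refutes M ι μ r (S.map compToQ)) {l : List PForm}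
    (hl : ∀ φ ∈ l, ¬ M.toP.Forces (ι r) φ) : ¬ M.toP.Forces (ι r) (compInterp S.root l) := by
  have hroot : (S.map compToQ).root = compToQ S.root := by
    clear h
    induction S <;> simp_all [Nested.map, root]
  have hc := h.root
  rw [hroot] at hc
  simp only [CompSat, compToQ, not_forall] at hc
  obtain ⟨-, hin, hout⟩ := hc
  refine M.toP.not_forces_compInterp (fun φ hφ => ?_) (fun φ hφ hf => hout ?_) hl
  · exact M.forces_toQ.1 (hin _ (Multiset.mem_map.2 ⟨_, hφ, rfl⟩))
  · exact ⟨φ.toQ, Multiset.mem_map.2 ⟨_, hφ, rfl⟩, M.forces_toQ.2 hf⟩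

theorem not_forces_nestInterps {M : QModel} {ι : Lab → M.W} {μ : Var → M.U} {r : Lab}
    {S : PSeq} (h : QSeq.Refutes M ι μ r (S.map compToQ)) :
    ∀ φ ∈ PSeq.nestInterps S, ¬ M.toP.Forces (ι r) φ := by
  induction S generalizing r with
  | flat c => simp [PSeq.nestInterps]
  | nest S w T ihS ihT =>
    intro φ hφ hf
    rcases List.mem_append.1 hφ with hφ | hφ
    · exact ihS h.left φ hφ hf
    · obtain rfl := List.mem_singleton.1 hφ
      have hrw : ι r ≤ ι w := h.edge _ _ (by simp [Nested.map, edgesFrom])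
      exact not_forces_compInterp_root h.right (ihT h.right) (M.toP.forces_mono hrw hf)

/-- Completeness of the calculi for the propositional logics, from the calculus for `ND` or `GN`. -/
theorem PSeq.derivable_of_valid {K : PLogic} {S : PSeq} (hS : S.UniqueLabels)
    (hv : PSeq.Valid K S) : PDerivable K S := by
  obtain ⟨L, hL, hK⟩ : ∃ L : QLogic, (L.IsGodel → K = .GD) ∧ (K = .GD → L.IsGodel) := by
    cases K
    · exact ⟨.ND, by simp [QLogic.IsGodel], by simp⟩
    · exact ⟨.GN, by simp, by simp [QLogic.IsGodel]⟩
  have hS' : (S.map compToQ).UniqueLabels := by simpa [UniqueLabels] using hS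
  have hd : QDerivable L (S.map compToQ) := by
    by_contra hnd
    obtain ⟨M, ι, μ, hM, -, h⟩ := QSeq.Und.exists_refutes ⟨hS', hnd⟩
    refine not_forces_compInterp_root h (not_forces_nestInterps h) (hv M.toP ?_ (ι 0))
    cases K
    · trivial
    · exact hM.2 (hK rfl)
  simpa only [map_map_of_leftInverse compToP_compToQ] using
    hd.toP hL (all_map compQFree_compToQ S)

end NestedCalculi

/-- Cut-free completeness of the nested calculi for `I`, `GD`, `ND`, `CD`, `GN` and `GC`. -/
theorem mainTheorem1 :
    (∀ (L : NestedCalculi.PLogic) (S : NestedCalculi.PSeq),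
      S.UniqueLabels → NestedCalculi.PSeq.Valid L S → NestedCalculi.PDerivable L S) ∧
    (∀ (L : NestedCalculi.QLogic) (S : NestedCalculi.QSeq),
      S.UniqueLabels → NestedCalculi.QSeq.Valid L S → NestedCalculi.QDerivable L S) :=
  ⟨fun _ _ hS hv => NestedCalculi.PSeq.derivable_of_valid hS hv,
    fun _ _ hS hv => NestedCalculi.QSeq.derivable_of_valid hS hv⟩
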